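/- **Setting.** Consider $N$ agents $\dot x_i=Ax_i+Bu_i$ with $A\in\mathbb R^{n\times n}$, $B\in\mathbb R^{n\times m}$, partitioned into $p$ nonempty clusters $V_1,\dots,V_p$ ($\bar i$ denotes the cluster of agent $i$), and leaders $\dot z_\ell=Az_\ell$, $\ell=1,\dots,p$. The zero-trust network has weights $a_{ij}(t)=\gamma_{ij}(t)\alpha_{ij}$, where $\gamma_{ij}(t)$ is the trust metric and $\alpha_{ij}$ are nominal edge weights, the Laplacian $L(t)=\operatorname{diag}\big(\sum_j a_{ij}(t)\big)_i-[a_{ij}(t)]$, and pinning gains $d_i(t)$, with $D(t)=\operatorname{diag}(d_1(t),\dots,d_N(t))$. For coupling strengths $c_1,\dots,c_p$, a gain $K$ and $\epsilon>0$, the pinning controller is $$u_i=K\Big[\sum_{j=1}^N c_{ij}\,a_{ij}(t/\epsilon)(x_j-x_i)+c_{\bar i}\,d_i(t/\epsilon)(z_{\bar i}-x_i)\Big],\qquad c_{ij}=c_{\bar i}\ \text{if } \bar i=\bar j,\quad c_{ij}=1\ \text{otherwise.}$$ A bounded measurable matrix function $F$ on $[0,\infty)$ *has the average* $F^\infty$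 if there are $\kappa>0$ and a decreasing bounded $\beta$ with $\beta(t)\to0$ as $t\to\infty$ such that $\big\|\frac1t\int_{t_0}^{t_0+t}F(\tau)\,d\tau-F^\infty\big\|\le\kappa\beta(t)$ for all $t_0\ge0$, $t>0$. **Assumptions.** 1. $(A,B)$ is stabilizable. 2. (In-degree balance) $\sum_{j\in V_\ell}a_{ij}(t)=0$ for all $t\ge0$, all $\ell$ and all $i\notin V_\ell$. 3. $L$ and $D$ have averages $L^\infty$ and $D^\infty$, and the averages of the pinning gains and of the weights inside each cluster are nonnegative. For each $\ell$, the average digraph of cluster $V_\ell$ together with its leader has a directed spanning tree; here there is an edge from $j$ to $i$ ($i\ne j$ in $V_\ell$) if $L^\infty_{ij}\neq0$, an edge from the leader to $i$ if $D^\infty_{ii}\ne0$, and no edge into the leader. Let $H_\ell$ be the diagonal block of $L^\infty+D^\infty$ on $V_\ell$, and let $L_0^\infty$ be $L^\infty$ with its diagonal blocks replaced by $0$. For $c=(c_1,\dots,c_p)$ put $\tilde L^\infty=\operatorname{diag}(c_1H_1,\dots,c_pH_p)+L_0^\infty$. **Theorem.** There is a positive diagonal matrix $\Xi=\operatorname{diag}(\Xi_1,\dots,\Xi_p)$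 with $\Xi_\ell H_\ell+H_\ell^T\Xi_\ell>0$ for all $\ell$. Let $\Xi$ be any such matrix, and let the coupling strengths satisfy $$c_\ell>\frac{-\lambda_{\min}\big(\Xi L_0^\infty+(L_0^\infty)^T\Xi\big)}{\lambda_{\min}\big(\Xi_\ell H_\ell+H_\ell^T\Xi_\ell\big)},\qquad \ell=1,\dots,p.$$ Then there is $P>0$ such that, for some $\xi>0$, $$\Xi\tilde L^\infty+(\tilde L^\infty)^T\Xi>\xi\,\Xi,\qquad PA+A^TP-\xi\,PBB^TP\le-\xi P .$$ For every such $P$ and the gain $K=B^TP$ there is $\epsilon^*>0$ such that for every $0<\epsilon<\epsilon^*$ the system under the pinning controller achieves cluster synchronization globally, uniformly and exponentially: there are $M,\rho>0$ such that for all $t_0\ge0$ and all solutions on $[t_0,\infty)$, the stacked error $e=(x_i-z_{\bar i})_{i=1}^N$ satisfies $\|e(t)\|\le Me^{-\rho(t-t_0)}\|e(t_0)\|$ for all $t\ge t_0$. -/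

import Mathlib

open Matrix Set Filter Topology

noncomputable section

namespace ClusterSync

/-- A real square matrix is Hurwitz: every complex eigenvalue has negative real part. -/
def IsHurwitz {n : ℕ} (A : Matrix (Fin n) (Fin n) ℝ) : Prop :=
  ∀ μ ∈ spectrum ℂ (A.map (fun r : ℝ => (r : ℂ))), μ.re < 0

/-- `(A, B)` is stabilizable: some linear state feedback makes the closed loop Hurwitz. -/
def Stabilizable {n m : ℕ} (A : Matrix (Fin n) (Fin n) ℝ) (B : Matrix (Fin n) (Fin m) ℝ) : Prop :=
  ∃ F : Matrix (Fin m) (Fin n) ℝ, IsHurwitz (A + B * F)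

/-- The least eigenvalue of a (symmetric, nonempty) real matrix. -/
def minEigenvalue {ι : Type*} [Fintype ι] [DecidableEq ι] (S : Matrix ι ι ℝ) : ℝ :=
  sInf (spectrum ℝ S)

/-- The zero trust adjacency matrix `a i j (t) = γ i j (t) * α i j`, where `γ` is the trust metric
and `α` are the nominal edge weights (row `i` lists the weights of the edges `(j, i)`). -/
def trustAdjacency {N : ℕ} (γ : ℝ → Matrix (Fin N) (Fin N) ℝ) (α : Matrix (Fin N) (Fin N) ℝ)
    (t : ℝ) : Matrix (Fin N) (Fin N) ℝ :=
  Matrix.of fun i j => γ t i j * α i j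

/-- The Laplacian: degree matrix minus adjacency matrix. -/
def laplacian {N : ℕ} (a : Matrix (Fin N) (Fin N) ℝ) : Matrix (Fin N) (Fin N) ℝ :=
  Matrix.diagonal (fun i => ∑ j, a i j) - a

/-- In-degree balance of the inter-cluster couplings (`cl i` is the cluster of agent `i`). -/
def InDegreeBalanced {N p : ℕ} (cl : Fin N → Fin p) (a : Matrix (Fin N) (Fin N) ℝ) : Prop :=
  ∀ (l : Fin p) (i : Fin N), cl i ≠ l → ∑ j with cl j = l, a i j = 0

/-- A measurable matrix function `L`, bounded on `[0, ∞)`, has the average `Linf`: the means over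
`[t₀, t₀ + t]` converge to `Linf` as `t → ∞` with a decreasing bound `κ * β t` that tends to `0`
and does not depend on `t₀`. -/
structure HasAverage {N : ℕ} (L : ℝ → Matrix (Fin N) (Fin N) ℝ)
    (Linf : Matrix (Fin N) (Fin N) ℝ) : Prop where
  measurable : ∀ i j, Measurable fun t => L t i j
  bounded : ∃ C : ℝ, ∀ t, 0 ≤ t → ∀ i j, |L t i j| ≤ C
  average : ∃ (κ : ℝ) (β : ℝ → ℝ), 0 < κ ∧ AntitoneOn β (Ici 0) ∧ Tendsto β atTop (𝓝 0) ∧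
    ∀ t₀ t : ℝ, 0 ≤ t₀ → 0 < t → ∀ i j,
      |1 / t * (∫ τ in t₀..(t₀ + t), L τ i j) - Linf i j| ≤ κ * β t

/-- A digraph has a directed spanning tree: a subgraph `T` on all the vertices with a root without
incoming edges, in which every other vertex has exactly one incoming edge and is reached by a
directed path from the root. -/
def HasSpanningTree {W : Type*} (G : Digraph W) : Prop :=
  ∃ (r : W) (T : Digraph W), T ≤ G ∧ (∀ u, ¬ T.Adj u r) ∧ (∀ v, v ≠ r → ∃! u, T.Adj u v) ∧
    ∀ v, Relation.ReflTransGen T.Adj r v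

/-- The digraph of cluster `l` together with its leader (the vertex `none`), induced by a Laplacian
`L` and a diagonal pinning matrix `D`: there is an edge from `j` to `i` if `L i j ≠ 0`, and an edge
from the leader to `i` if `D i i ≠ 0`; no edge enters the leader. -/
def leaderGraph {N p : ℕ} (cl : Fin N → Fin p) (L D : Matrix (Fin N) (Fin N) ℝ) (l : Fin p) :
    Digraph (Option {i : Fin N // cl i = l}) where
  Adj u v := match u, v with
    | _, none => False
    | none, some i => D i i ≠ 0
    | some j, some i => j ≠ i ∧ L i j ≠ 0

/-- The coupling strength of the pair `(i, j)`: that of the cluster inside a cluster, and `1`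
between different clusters. -/
def coupling {N p : ℕ} (cl : Fin N → Fin p) (c : Fin p → ℝ) (i j : Fin N) : ℝ :=
  if cl i = cl j then c (cl i) else 1

/-- The diagonal block of cluster `l` of a matrix. -/
def block {N p : ℕ} (cl : Fin N → Fin p) (l : Fin p) (X : Matrix (Fin N) (Fin N) ℝ) :
    Matrix {i : Fin N // cl i = l} {i : Fin N // cl i = l} ℝ :=
  X.submatrix Subtype.val Subtype.val

/-- The part of a matrix outside the diagonal blocks of the clusters. -/
def offBlock {N p : ℕ} (cl : Fin N → Fin p) (X : Matrix (Fin N) (Fin N) ℝ) :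
    Matrix (Fin N) (Fin N) ℝ :=
  Matrix.of fun i j => if cl i = cl j then 0 else X i j

/-- The pinned Laplacian with coupling strengths: the block of cluster `l` is `c l` times the block
of `L + D`, and the blocks between different clusters are those of `L`. -/
def coupledLaplacian {N p : ℕ} (cl : Fin N → Fin p) (c : Fin p → ℝ)
    (L D : Matrix (Fin N) (Fin N) ℝ) : Matrix (Fin N) (Fin N) ℝ :=
  Matrix.of fun i j => coupling cl c i j * L i j + c (cl i) * D i j

/-- The symmetric matrix `Ξ X + Xᵀ Ξ`. -/
def weightedSym {ι : Type*} [Fintype ι] (Ξ X : Matrix ι ι ℝ) : Matrix ι ι ℝ :=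
  Ξ * X + Xᵀ * Ξ

/-- `σ` gives a positive diagonal matrix `Ξ = diag σ` such that, on each cluster `l`, the matrix
`Ξ_l H_l + H_lᵀ Ξ_l` is positive definite, where `H_l` is the block of `H`. -/
def IsWeighting {N p : ℕ} (cl : Fin N → Fin p) (H : Matrix (Fin N) (Fin N) ℝ)
    (σ : Fin N → ℝ) : Prop :=
  (∀ i, 0 < σ i) ∧
    ∀ l, (weightedSym (block cl l (Matrix.diagonal σ)) (block cl l H)).PosDef

/-- The lower bound for the coupling strength of cluster `l`:
`-λ_min(Ξ L₀ + L₀ᵀ Ξ) / λ_min(Ξ_l H_l + H_lᵀ Ξ_l)`, where `H_l` is the block of `L + D` and `L₀` is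
the inter-cluster part of `L`. -/
def couplingThreshold {N p : ℕ} (cl : Fin N → Fin p) (L D : Matrix (Fin N) (Fin N) ℝ)
    (σ : Fin N → ℝ) (l : Fin p) : ℝ :=
  -minEigenvalue (weightedSym (Matrix.diagonal σ) (offBlock cl L)) /
    minEigenvalue (weightedSym (block cl l (Matrix.diagonal σ)) (block cl l (L + D)))

/-- The matrices `P` from which the gain `K = Bᵀ P` is formed, for the averaged coupled Laplacian
`Lc` and the weighting `Ξ = diag σ`: `P > 0` and, for some `ξ > 0`, `Ξ Lc + Lcᵀ Ξ > ξ Ξ` and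
`P A + Aᵀ P - ξ P B Bᵀ P ≤ - ξ P`. -/
def IsGainDesign {n m N : ℕ} (A : Matrix (Fin n) (Fin n) ℝ) (B : Matrix (Fin n) (Fin m) ℝ)
    (Lc : Matrix (Fin N) (Fin N) ℝ) (σ : Fin N → ℝ) (P : Matrix (Fin n) (Fin n) ℝ) : Prop :=
  P.PosDef ∧ ∃ ξ : ℝ, 0 < ξ ∧
    (weightedSym (Matrix.diagonal σ) Lc - ξ • Matrix.diagonal σ).PosDef ∧
    (-(ξ • P) - (P * A + Aᵀ * P - ξ • (P * B * Bᵀ * P))).PosSemidef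

/-- The pinning controller of agent `i` with gain `K`, adjacency matrix `a`, pinning gains `d`, agent
states `x` and leader states `z`. -/
def pinningControl {n m N p : ℕ} (cl : Fin N → Fin p) (c : Fin p → ℝ) (K : Matrix (Fin m) (Fin n) ℝ)
    (a : Matrix (Fin N) (Fin N) ℝ) (d : Fin N → ℝ) (x : Fin N → Fin n → ℝ)
    (z : Fin p → Fin n → ℝ) (i : Fin N) : Fin m → ℝ :=
  K *ᵥ (∑ j, (coupling cl c i j * a i j) • (x j - x i) + (c (cl i) * d i) • (z (cl i) - x i))

/-- `x` (agents) and `z` (leaders) solve `x_i' = A x_i + B u_i` and `z_l' = A z_l` on `[t₀, ∞)`, in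
the sense of Carathéodory (classically where the coefficients are continuous), under the pinning
controller with topology `a (t / ε)`, `d (t / ε)`. -/
structure IsTrajectory {n m N p : ℕ} (A : Matrix (Fin n) (Fin n) ℝ) (B : Matrix (Fin n) (Fin m) ℝ)
    (cl : Fin N → Fin p) (c : Fin p → ℝ) (K : Matrix (Fin m) (Fin n) ℝ)
    (a : ℝ → Matrix (Fin N) (Fin N) ℝ) (d : ℝ → Fin N → ℝ) (ε t₀ : ℝ)
    (x : ℝ → Fin N → Fin n → ℝ) (z : ℝ → Fin p → Fin n → ℝ) : Prop where
  agents_continuous : ∀ i, ContinuousOn (fun t => x t i) (Ici t₀)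
  leaders_continuous : ∀ l, ContinuousOn (fun t => z t l) (Ici t₀)
  agents_eq : ∀ i t, t₀ ≤ t → x t i = x t₀ i +
    ∫ s in t₀..t, (A *ᵥ x s i + B *ᵥ pinningControl cl c K (a (s / ε)) (d (s / ε)) (x s) (z s) i)
  leaders_eq : ∀ l t, t₀ ≤ t → z t l = z t₀ l + ∫ s in t₀..t, A *ᵥ z s l

/-- The Euclidean norm of the stacked synchronization error `(x_i - z_{cl i})_i`. -/
def errorNorm {n N p : ℕ} (cl : Fin N → Fin p) (x : Fin N → Fin n → ℝ) (z : Fin p → Fin n → ℝ) :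
    ℝ :=
  Real.sqrt (∑ i, ∑ k, (x i k - z (cl i) k) ^ 2)

/-- Global uniform exponential cluster synchronization under the pinning controller: the error
decays exponentially along all trajectories, with constants that depend neither on the initial
time nor on the trajectory. -/
def ExponentialClusterSync {n m N p : ℕ} (A : Matrix (Fin n) (Fin n) ℝ)
    (B : Matrix (Fin n) (Fin m) ℝ) (cl : Fin N → Fin p) (c : Fin p → ℝ)
    (K : Matrix (Fin m) (Fin n) ℝ) (a : ℝ → Matrix (Fin N) (Fin N) ℝ) (d : ℝ → Fin N → ℝ)
    (ε : ℝ) : Prop :=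
  ∃ M rate : ℝ, 0 < M ∧ 0 < rate ∧
    ∀ (t₀ : ℝ) (x : ℝ → Fin N → Fin n → ℝ) (z : ℝ → Fin p → Fin n → ℝ), 0 ≤ t₀ →
      IsTrajectory A B cl c K a d ε t₀ x z →
      ∀ t, t₀ ≤ t →
        errorNorm cl (x t) (z t) ≤ M * Real.exp (-rate * (t - t₀)) * errorNorm cl (x t₀) (z t₀)

end ClusterSync

end

/-!
The proof has three parts, one for each assertion.

*Weighting.* By the in-degree balance, the block `H` of a cluster in `L + D` has nonpositive
off-diagonal entries and the averaged pinning gains as row sums. The leader is the root of the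
spanning tree, so the minimum principle makes `H` monotone: `H x ≥ 0` implies `x ≥ 0`
(`nonneg_of_mulVec_nonneg`). Hence `v = H⁻¹ 1` and `u = H⁻ᵀ 1` are positive, and `Ξ = diag (u / v)`
works, because `Ξ H + Hᵀ Ξ` maps `v` to a positive vector (`exists_weighting_of_monotone`).

*Gain.* Rayleigh bounds on the clusters and on the inter-cluster part show that `Ξ X + Xᵀ Ξ > 0` for
the coupled Laplacian `X` (`posDef_weightedSym_coupledLaplacian`), hence `Ξ X + Xᵀ Ξ > ξ Ξ` for small
`ξ`. A stabilizing feedback has a quadratic Lyapunov function (`exists_lyapunov`), which is a finite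
sum over the powers of an explicit Euler step; these tend to zero by Gelfand's formula. A small
multiple of its matrix, inverted, solves the Riccati inequality (`exists_riccati`).

*Synchronization.* The leader states cancel from the coupling terms by the in-degree balance, so the
errors `eᵢ = xᵢ - z_{cl i}` satisfy `eᵢ' = A eᵢ - B Bᵀ P ∑ⱼ Xᵢⱼ(t / ε) eⱼ`
(`IsTrajectory.isLinearSolution`). For the averaged system, `V e = ∑ σᵢ eᵢᵀ P eᵢ` decreases at rate `ξ`
(`lyapunov_decrease`). Over a short step of fixed length `h`, the true solution follows the Euler
step of the averaged system up to `O(h²) + o(h)` as `ε → 0`, so `V` still contracts by the factor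
`1 - h ξ / 2` per step (`IsLinearSolution.lyapunov_step`), which gives the exponential decay
(`exists_exponential_decay_of_average`).
-/

noncomputable section

namespace ClusterSync

/-! ### Quadratic forms on coordinate spaces -/

section Quadratic

variable {ι : Type*} [Fintype ι]

lemma dotProduct_mulVec_eq_sum (S : Matrix ι ι ℝ) (v w : ι → ℝ) :
    v ⬝ᵥ S *ᵥ w = ∑ i, ∑ j, v i * S i j * w j := by
  simp only [dotProduct, mulVec, Finset.mul_sum, mul_assoc]

lemma abs_dotProduct_mulVec_le (S : Matrix ι ι ℝ) (v w : ι → ℝ) :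
    |v ⬝ᵥ S *ᵥ w| ≤ (∑ i, ∑ j, |S i j|) * ‖v‖ * ‖w‖ := by
  rw [dotProduct_mulVec_eq_sum, Finset.sum_mul, Finset.sum_mul]
  refine (Finset.abs_sum_le_sum_abs _ _).trans (Finset.sum_le_sum fun i _ => ?_)
  rw [Finset.sum_mul, Finset.sum_mul]
  refine (Finset.abs_sum_le_sum_abs _ _).trans (Finset.sum_le_sum fun j _ => ?_)
  have hv : |v i| ≤ ‖v‖ := norm_le_pi_norm v i
  have hw : |w j| ≤ ‖w‖ := norm_le_pi_norm w j
  calc |v i * S i j * w j| = |v i| * |S i j| * |w j| := by rw [abs_mul, abs_mul]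
    _ ≤ ‖v‖ * |S i j| * ‖w‖ := by gcongr
    _ = |S i j| * ‖v‖ * ‖w‖ := by ring

lemma posDef_of_pos {S : Matrix ι ι ℝ} (hS : Sᵀ = S) (h : ∀ v, v ≠ 0 → 0 < v ⬝ᵥ S *ᵥ v) :
    S.PosDef :=
  PosDef.of_dotProduct_mulVec_pos (by rwa [IsHermitian, conjTranspose_eq_transpose_of_trivial])
    fun v hv => by simpa using h v hv

lemma posDef_transpose_eq {κ : Type*} {S : Matrix κ κ ℝ} (hS : S.PosDef) : Sᵀ = S := by
  have := hS.isHermitian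
  rwa [IsHermitian, conjTranspose_eq_transpose_of_trivial] at this

lemma posDef_pos {S : Matrix ι ι ℝ} (hS : S.PosDef) {v : ι → ℝ} (hv : v ≠ 0) :
    0 < v ⬝ᵥ S *ᵥ v := by
  simpa using hS.dotProduct_mulVec_pos hv

lemma posDef_nonneg {S : Matrix ι ι ℝ} (hS : S.PosDef) (v : ι → ℝ) : 0 ≤ v ⬝ᵥ S *ᵥ v := by
  simpa using hS.posSemidef.dotProduct_mulVec_nonneg v

/-- A positive definite form is bounded below on the unit sphere, by compactness. -/
lemma exists_mul_sq_le_of_posDef {S : Matrix ι ι ℝ} (hS : S.PosDef) :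
    ∃ a : ℝ, 0 < a ∧ ∀ v, a * ‖v‖ ^ 2 ≤ v ⬝ᵥ S *ᵥ v := by
  rcases isEmpty_or_nonempty ι with hι | hι
  · exact ⟨1, one_pos, fun v => by simp [Subsingleton.elim v 0]⟩
  have hcont : Continuous fun v : ι → ℝ => v ⬝ᵥ S *ᵥ v := by
    simp only [dotProduct_mulVec_eq_sum]
    fun_prop
  obtain ⟨u, hu, hmin⟩ := (isCompact_sphere (0 : ι → ℝ) 1).exists_isMinOn
    (NormedSpace.sphere_nonempty.2 zero_le_one) hcont.continuousOn
  have hu0 : u ≠ 0 := by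
    rintro rfl
    simp at hu
  refine ⟨u ⬝ᵥ S *ᵥ u, posDef_pos hS hu0, fun v => ?_⟩
  rcases eq_or_ne v 0 with rfl | hv
  · simp
  have hnv : ‖v‖ ≠ 0 := norm_ne_zero_iff.2 hv
  have hw : ‖v‖⁻¹ • v ∈ Metric.sphere (0 : ι → ℝ) 1 := by
    simp [norm_smul, hnv]
  have h := hmin hw
  simp only [mem_ofPred_eq, mulVec_smul, smul_dotProduct, dotProduct_smul, smul_eq_mul] at h
  calc u ⬝ᵥ S *ᵥ u * ‖v‖ ^ 2 ≤ ‖v‖⁻¹ * (‖v‖⁻¹ * v ⬝ᵥ S *ᵥ v) * ‖v‖ ^ 2 := by gcongr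
    _ = v ⬝ᵥ S *ᵥ v := by field_simp

/-- Positive definiteness is stable under small symmetric perturbations. -/
lemma exists_posDef_sub_smul {S T : Matrix ι ι ℝ} (hS : S.PosDef) (hT : Tᵀ = T) :
    ∃ δ : ℝ, 0 < δ ∧ ∀ s, 0 ≤ s → s ≤ δ → (S - s • T).PosDef := by
  obtain ⟨a, ha, hle⟩ := exists_mul_sq_le_of_posDef hS
  set b := ∑ i, ∑ j, |T i j|
  have hb : 0 ≤ b := Finset.sum_nonneg fun i _ => Finset.sum_nonneg fun j _ => abs_nonneg _
  refine ⟨a / (b + 1), by positivity, fun s hs hsa => posDef_of_pos ?_ fun v hv => ?_⟩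
  · rw [transpose_sub, transpose_smul, hT, posDef_transpose_eq hS]
  · have h1 := hle v
    have h2 := (le_abs_self _).trans (abs_dotProduct_mulVec_le T v v)
    have h3 : s * (b + 1) ≤ a := (le_div_iff₀ (by positivity)).1 hsa
    have hv2 : 0 < ‖v‖ ^ 2 := pow_pos (norm_pos_iff.2 hv) 2
    have h5 : 0 < a - s * b := by
      rcases hs.eq_or_lt with rfl | hs'
      · simpa using ha
      · linarith
    rw [sub_mulVec, smul_mulVec, dotProduct_sub, dotProduct_smul, smul_eq_mul]
    calc 0 < (a - s * b) * ‖v‖ ^ 2 := by positivity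
      _ = a * ‖v‖ ^ 2 - s * (b * ‖v‖ * ‖v‖) := by ring
      _ ≤ _ := sub_le_sub h1 (mul_le_mul_of_nonneg_left h2 hs)

end Quadratic

/-! ### Diagonal weightings of monotone Z-matrices -/

section Weighting

variable {ι : Type*} [Fintype ι]

/-- Substituting `x = v y` turns the form of `S` into
`∑ (S v)ᵢ vᵢ yᵢ² - ½ ∑ Sᵢⱼ vᵢ vⱼ (yᵢ - yⱼ)²`, in which every term is nonnegative. -/
lemma posDef_of_mulVec_pos {S : Matrix ι ι ℝ} (hS : Sᵀ = S) (hZ : ∀ i j, i ≠ j → S i j ≤ 0)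
    {v : ι → ℝ} (hv : ∀ i, 0 < v i) (hSv : ∀ i, 0 < (S *ᵥ v) i) : S.PosDef := by
  refine posDef_of_pos hS fun x hx => ?_
  have hsymm : ∀ i j, S j i = S i j := fun i j => congrFun₂ hS i j
  obtain ⟨y, rfl⟩ : ∃ y : ι → ℝ, x = fun i => v i * y i :=
    ⟨fun i => x i / v i, funext fun i => by have := (hv i).ne'; field_simp⟩
  have key : (fun i => v i * y i) ⬝ᵥ S *ᵥ (fun i => v i * y i) =
      (∑ i, (S *ᵥ v) i * v i * y i ^ 2) +
        ∑ i, ∑ j, -(S i j) * v i * v j * (y i - y j) ^ 2 / 2 := by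
    have e1 : ∑ i, ∑ j, S i j * v j * v i * y i ^ 2 = ∑ i, ∑ j, S i j * v j * v i * y j ^ 2 := by
      rw [Finset.sum_comm]
      exact Finset.sum_congr rfl fun i _ => Finset.sum_congr rfl fun j _ => by
        rw [hsymm]; ring
    have e2 : ∑ i, (S *ᵥ v) i * v i * y i ^ 2 = ∑ i, ∑ j, S i j * v j * v i * y i ^ 2 := by
      simp only [mulVec, dotProduct, Finset.sum_mul]
    have e3 : ∑ i, ∑ j, S i j * v j * v i * y i ^ 2 =
        ∑ i, ∑ j, (S i j * v j * v i * y i ^ 2 + S i j * v j * v i * y j ^ 2) / 2 := by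
      simp only [← Finset.sum_div, Finset.sum_add_distrib, ← e1]
      ring
    rw [e2, e3, dotProduct_mulVec_eq_sum, ← Finset.sum_add_distrib]
    refine Finset.sum_congr rfl fun i _ => ?_
    rw [← Finset.sum_add_distrib]
    exact Finset.sum_congr rfl fun j _ => by ring
  rw [key]
  obtain ⟨k, hk⟩ : ∃ k, y k ≠ 0 := by
    by_contra! h
    exact hx (funext fun i => by simp [h i])
  refine add_pos_of_pos_of_nonneg (Finset.sum_pos' (fun i _ => ?_) ⟨k, Finset.mem_univ _, ?_⟩)
    (Finset.sum_nonneg fun i _ => Finset.sum_nonneg fun j _ => ?_)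
  · have := hv i
    have := hSv i
    positivity
  · have := hv k
    have := hSv k
    positivity
  · rcases eq_or_ne i j with rfl | hij
    · simp
    · have := hv i
      have := hv j
      have := neg_nonneg.2 (hZ i j hij)
      positivity

/-- If `H` is monotone with nonpositive off-diagonal entries, then `v = H⁻¹ 1` and `u = H⁻ᵀ 1` are
positive and `Ξ = diag (u / v)` works: `(Ξ H + Hᵀ Ξ) v = Ξ 1 + Hᵀ u > 0`. -/
theorem exists_weighting_of_monotone [DecidableEq ι] {H : Matrix ι ι ℝ} (hZ : ∀ i j, i ≠ j → H i j ≤ 0)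
    (hM : ∀ x : ι → ℝ, (∀ i, 0 ≤ (H *ᵥ x) i) → ∀ i, 0 ≤ x i) :
    ∃ σ : ι → ℝ, (∀ i, 0 < σ i) ∧ (weightedSym (diagonal σ) H).PosDef := by
  have hunit : IsUnit H := by
    rw [← mulVec_injective_iff_isUnit]
    intro x y hxy
    have h1 := hM (x - y) fun i => by rw [mulVec_sub, hxy, sub_self]; rfl
    have h2 := hM (y - x) fun i => by rw [mulVec_sub, hxy, sub_self]; rfl
    ext i
    have h1i := h1 i
    have h2i := h2 i
    simp only [Pi.sub_apply] at h1i h2i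
    linarith
  have hdet := (isUnit_iff_isUnit_det H).1 hunit
  have hinv : ∀ i j, 0 ≤ H⁻¹ i j := fun i j => by
    have := hM (H⁻¹ *ᵥ Pi.single j 1) (fun k => by
      rw [mulVec_mulVec, mul_nonsing_inv _ hdet, one_mulVec]
      exact (Pi.single_nonneg (α := fun _ => ℝ) (i := j)).2 zero_le_one k) i
    simpa using this
  -- A nonnegative vector whose image under a matrix with the sign pattern of `H` is positive is
  -- itself positive.
  have hpos : ∀ G : Matrix ι ι ℝ, (∀ i j, i ≠ j → G i j ≤ 0) → ∀ w : ι → ℝ, (∀ i, 0 ≤ w i) →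
      (∀ i, 0 < (G *ᵥ w) i) → ∀ i, 0 < w i := by
    intro G hG w hw hGw i
    refine (hw i).lt_of_ne fun h0 => (hGw i).not_ge ?_
    refine Finset.sum_nonpos fun j _ => ?_
    rcases eq_or_ne i j with rfl | hij
    · rw [← h0, mul_zero]
    · exact mul_nonpos_of_nonpos_of_nonneg (hG i j hij) (hw j)
  set v : ι → ℝ := H⁻¹ *ᵥ 1
  set u : ι → ℝ := H⁻¹ᵀ *ᵥ 1
  have hHv : H *ᵥ v = 1 := by
    rw [mulVec_mulVec, mul_nonsing_inv _ hdet, one_mulVec]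
  have hHu : Hᵀ *ᵥ u = 1 := by
    rw [mulVec_mulVec, ← transpose_mul, nonsing_inv_mul _ hdet, transpose_one, one_mulVec]
  have hv : ∀ i, 0 < v i := hpos H hZ v
    (fun i => Finset.sum_nonneg fun j _ => by simpa using hinv i j) fun i => by simp [hHv]
  have hu : ∀ i, 0 < u i := hpos Hᵀ (fun i j hij => hZ j i hij.symm) u
    (fun i => Finset.sum_nonneg fun j _ => by simpa using hinv j i) fun i => by simp [hHu]
  refine ⟨fun i => u i / v i, fun i => div_pos (hu i) (hv i),
    posDef_of_mulVec_pos ?_ ?_ hv fun i => ?_⟩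
  · simp [weightedSym, transpose_add, transpose_mul, add_comm]
  · intro i j hij
    have h1 := hZ i j hij
    have h2 := hZ j i hij.symm
    have h3 := div_pos (hu i) (hv i)
    have h4 := div_pos (hu j) (hv j)
    simp only [weightedSym, Matrix.add_apply, diagonal_mul, mul_diagonal, transpose_apply]
    nlinarith
  · have huv : diagonal (fun i => u i / v i) *ᵥ v = u := by
      ext k
      have := (hv k).ne'
      rw [mulVec_diagonal]
      field_simp
    rw [weightedSym, add_mulVec, ← mulVec_mulVec, ← mulVec_mulVec, hHv, huv, hHu]
    simp only [Pi.add_apply, mulVec_diagonal, Pi.one_apply, mul_one]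
    have := div_pos (hu i) (hv i)
    linarith

/-- The minimum principle: a matrix with nonpositive off-diagonal entries and nonnegative row sums is
monotone if every nonempty set of indices has a row with a positive sum or an entry leading out of
the set. -/
theorem nonneg_of_mulVec_nonneg {H : Matrix ι ι ℝ} (hZ : ∀ i j, i ≠ j → H i j ≤ 0)
    (hrow : ∀ i, 0 ≤ ∑ j, H i j)
    (hreach : ∀ s : Set ι, s.Nonempty → ∃ i ∈ s, 0 < ∑ j, H i j ∨ ∃ j ∉ s, H i j ≠ 0)
    {x : ι → ℝ} (hx : ∀ i, 0 ≤ (H *ᵥ x) i) (i : ι) : 0 ≤ x i := by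
  have : Nonempty ι := ⟨i⟩
  obtain ⟨k, hk⟩ := Finite.exists_min x
  refine le_trans ?_ (hk i)
  by_contra! hneg
  obtain ⟨r, hr, hr'⟩ := hreach {r | x r = x k} ⟨k, rfl⟩
  have hr : x r = x k := hr
  have hterm : ∀ j, H r j * (x j - x k) ≤ 0 := fun j => by
    rcases eq_or_ne r j with rfl | hrj
    · simp [hr]
    · exact mul_nonpos_of_nonpos_of_nonneg (hZ r j hrj) (sub_nonneg.2 (hk j))
  have hsplit : (H *ᵥ x) r = (∑ j, H r j) * x k + ∑ j, H r j * (x j - x k) := by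
    simp only [mulVec, dotProduct, Finset.sum_mul, ← Finset.sum_add_distrib]
    exact Finset.sum_congr rfl fun j _ => by ring
  have h0 := hx r
  have hsum : ∑ j, H r j * (x j - x k) ≤ 0 := Finset.sum_nonpos fun j _ => hterm j
  rcases hr' with hpos | ⟨j, hj, hne⟩
  · nlinarith
  · have hlt : ∑ j, H r j * (x j - x k) < 0 :=
      Finset.sum_neg' (fun j _ => hterm j) ⟨j, Finset.mem_univ _, by
        have hrj : r ≠ j := by
          rintro rfl
          exact hj hr
        exact mul_neg_of_neg_of_pos ((hZ r j hrj).lt_of_ne hne)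
          (sub_pos.2 ((hk j).lt_of_ne fun h => hj h.symm))⟩
    nlinarith [hrow r]

end Weighting

/-! ### Weightings of the clusters -/

section Clusters

variable {N p : ℕ} {cl : Fin N → Fin p} {L D : Matrix (Fin N) (Fin N) ℝ}

/-- No edge enters the leader, so it is the root of every spanning tree. -/
lemma exists_edge_of_hasSpanningTree {l : Fin p} (h : HasSpanningTree (leaderGraph cl L D l))
    {s : Set {i : Fin N // cl i = l}} (hs : s.Nonempty) :
    ∃ i ∈ s, D i i ≠ 0 ∨ ∃ j ∉ s, L i j ≠ 0 := by
  obtain ⟨r, T, hT, -, -, hreach⟩ := h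
  have hr : r = none := by
    rcases Relation.ReflTransGen.cases_tail (hreach none) with h | ⟨u, -, hu⟩
    · exact h.symm
    · have := hT hu
      cases u <;> exact this.elim
  subst hr
  by_contra! hcon
  obtain ⟨i, hi⟩ := hs
  have key : ∀ v, Relation.ReflTransGen T.Adj none v → ∀ i ∈ s, v ≠ some i := by
    intro v hv
    induction hv with
    | refl => simp
    | @tail u v _ huv ih =>
      rintro i hi rfl
      have hadj := hT huv
      cases u with
      | none => exact hadj (hcon i hi).1
      | some j => exact hadj.2 ((hcon i hi).2 j fun hj => ih j hj rfl)
  exact key _ (hreach (some i)) i hi rfl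

lemma block_diagonal (σ : Fin N → ℝ) (l : Fin p) :
    block cl l (diagonal σ) = diagonal fun i : {i : Fin N // cl i = l} => σ i := by
  ext i j
  simp [block, diagonal_apply, Subtype.ext_iff]

/-- Inside each cluster `L + D` is a Z-matrix with row sums `D`, and the spanning tree makes it
monotone; the weightings of the clusters are then put together. -/
theorem exists_isWeighting (hLrow : ∀ i, ∑ j with cl j = cl i, L i j = 0)
    (hL : ∀ i j, i ≠ j → cl i = cl j → L i j ≤ 0) (hD : ∀ i, 0 ≤ D i i)
    (hDdiag : ∀ i j, i ≠ j → D i j = 0)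
    (htree : ∀ l, HasSpanningTree (leaderGraph cl L D l)) :
    ∃ σ : Fin N → ℝ, IsWeighting cl (L + D) σ := by
  have hrow : ∀ l (i : {i : Fin N // cl i = l}), ∑ j, block cl l (L + D) i j = D i i := by
    rintro l ⟨i, rfl⟩
    have h1 : ∑ j : {j : Fin N // cl j = cl i}, L i j = 0 := by
      rw [← hLrow i]
      exact (Finset.sum_subtype _ (by simp) _).symm
    have h2 : ∑ j : {j : Fin N // cl j = cl i}, D i j = D i i :=
      Finset.sum_eq_single_of_mem (⟨i, rfl⟩ : {j : Fin N // cl j = cl i}) (Finset.mem_univ _)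
        fun j _ hj => hDdiag i j fun h => hj (Subtype.ext h.symm)
    simp only [block, submatrix_apply, Matrix.add_apply, Finset.sum_add_distrib, h1, h2, zero_add]
  have hoff : ∀ l (i j : {i : Fin N // cl i = l}), i ≠ j → block cl l (L + D) i j = L i j := by
    intro l i j hij
    simp [block, hDdiag i j fun h => hij (Subtype.ext h)]
  have hZ : ∀ l (i j : {i : Fin N // cl i = l}), i ≠ j → block cl l (L + D) i j ≤ 0 := by
    intro l i j hij
    rw [hoff l i j hij]
    exact hL i j (fun h => hij (Subtype.ext h)) (i.2.trans j.2.symm)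
  have hex : ∀ l, ∃ σ : {i : Fin N // cl i = l} → ℝ, (∀ i, 0 < σ i) ∧
      (weightedSym (diagonal σ) (block cl l (L + D))).PosDef := fun l => by
    refine exists_weighting_of_monotone (hZ l) fun x hx i =>
      nonneg_of_mulVec_nonneg (hZ l) (fun i => ?_) (fun s hs => ?_) hx i
    · rw [hrow]
      exact hD i
    · obtain ⟨i, hi, h⟩ := exists_edge_of_hasSpanningTree (htree l) hs
      refine ⟨i, hi, h.imp (fun h => ?_) fun ⟨j, hj, h⟩ => ⟨j, hj, ?_⟩⟩
      · rw [hrow]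
        exact (hD i).lt_of_ne' h
      · rwa [hoff l i j fun h => hj (h ▸ hi)]
  choose σ hσ hpd using hex
  refine ⟨fun i => σ (cl i) ⟨i, rfl⟩, fun i => hσ _ _, fun l => ?_⟩
  have : (fun i : {i : Fin N // cl i = l} => σ (cl i) ⟨i, rfl⟩) = σ l := by
    ext ⟨i, rfl⟩
    rfl
  rw [block_diagonal, this]
  exact hpd l

end Clusters

/-! ### Least eigenvalues and the coupled Laplacian -/

section Eigenvalue

variable {ι : Type*} [Fintype ι] [DecidableEq ι]

/-- The Rayleigh bound. -/
lemma minEigenvalue_mul_le {S : Matrix ι ι ℝ} (hS : Sᵀ = S) (v : ι → ℝ) :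
    minEigenvalue S * (v ⬝ᵥ v) ≤ v ⬝ᵥ S *ᵥ v := by
  have hbdd : BddBelow (spectrum ℝ S) := S.finite_real_spectrum.bddBelow
  have hsymm : (S - algebraMap ℝ _ (minEigenvalue S)).IsHermitian := by
    rw [IsHermitian, conjTranspose_eq_transpose_of_trivial, transpose_sub, hS,
      algebraMap_eq_diagonal, diagonal_transpose]
  have hpsd : (S - algebraMap ℝ _ (minEigenvalue S)).PosSemidef := by
    refine posSemidef_iff_isHermitian_and_spectrum_nonneg.2 ⟨hsymm, ?_⟩
    rw [← spectrum.sub_singleton_eq]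
    rintro _ ⟨μ, hμ, _, rfl, rfl⟩
    exact sub_nonneg.2 (csInf_le hbdd hμ)
  have h := hpsd.dotProduct_mulVec_nonneg v
  rw [star_trivial, sub_mulVec, dotProduct_sub, Algebra.algebraMap_eq_smul_one, smul_mulVec,
    one_mulVec, dotProduct_smul, smul_eq_mul] at h
  linarith

lemma minEigenvalue_pos [Nonempty ι] {S : Matrix ι ι ℝ} (hS : S.PosDef) :
    0 < minEigenvalue S := by
  have hrange := hS.isHermitian.spectrum_real_eq_range_eigenvalues
  have hne : (spectrum ℝ S).Nonempty := hrange ▸ range_nonempty _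
  obtain ⟨i, hi⟩ : minEigenvalue S ∈ range hS.isHermitian.eigenvalues :=
    hrange ▸ hne.csInf_mem S.finite_real_spectrum
  exact hi ▸ hS.eigenvalues_pos i

end Eigenvalue

lemma weightedSym_transpose {ι : Type*} [Fintype ι] [DecidableEq ι] (σ : ι → ℝ)
    (X : Matrix ι ι ℝ) : (weightedSym (diagonal σ) X)ᵀ = weightedSym (diagonal σ) X := by
  simp [weightedSym, transpose_add, transpose_mul, add_comm]

lemma weightedSym_diagonal_apply {ι : Type*} [Fintype ι] [DecidableEq ι] (σ : ι → ℝ)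
    (X : Matrix ι ι ℝ) (i j : ι) :
    weightedSym (diagonal σ) X i j = σ i * X i j + X j i * σ j := by
  simp [weightedSym]

/-- The form of the coupled Laplacian is the sum of the forms of the clusters, which the coupling
strengths scale, and of the inter-cluster form. The latter has zero diagonal, hence a nonpositive
least eigenvalue, so the coupling strengths above the threshold are positive. -/
theorem posDef_weightedSym_coupledLaplacian {N p : ℕ} {cl : Fin N → Fin p}
    (hcl : Function.Surjective cl) {L D : Matrix (Fin N) (Fin N) ℝ}
    (hDdiag : ∀ i j, i ≠ j → D i j = 0) {σ : Fin N → ℝ} (hσ : IsWeighting cl (L + D) σ)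
    {c : Fin p → ℝ} (hc : ∀ l, couplingThreshold cl L D σ l < c l) :
    (weightedSym (diagonal σ) (coupledLaplacian cl c L D)).PosDef := by
  set O := weightedSym (diagonal σ) (offBlock cl L) with hO
  set W := fun l => weightedSym (block cl l (diagonal σ)) (block cl l (L + D)) with hW
  have hWapply : ∀ l i j, W l i j = σ i * (L + D) i j + (L + D) j i * σ j := fun l i j => by
    simp only [hW, block_diagonal]
    rw [weightedSym_diagonal_apply]
    rfl
  have hWpd : ∀ l, (W l).PosDef := hσ.2
  have hne : ∀ l, Nonempty {i : Fin N // cl i = l} := fun l => by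
    obtain ⟨i, hi⟩ := hcl l
    exact ⟨⟨i, hi⟩⟩
  have hWpos : ∀ l, 0 < minEigenvalue (W l) := fun l => minEigenvalue_pos (hWpd l)
  have hOle : ∀ i : Fin N, minEigenvalue O ≤ 0 := fun i => by
    have h1 : O i i = 0 := by simp [hO, weightedSym_diagonal_apply, offBlock]
    simpa [h1] using minEigenvalue_mul_le (S := O) (weightedSym_transpose σ _) (Pi.single i 1)
  have hcW : ∀ l, 0 < c l * minEigenvalue (W l) + minEigenvalue O := fun l => by
    have := (div_lt_iff₀ (hWpos l)).1 (hc l)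
    linarith
  have hc0 : ∀ l, 0 ≤ c l := fun l => by
    obtain ⟨i, -⟩ := hcl l
    have h1 := hOle i
    have h2 := hcW l
    by_contra! h
    nlinarith [hWpos l]
  refine posDef_of_pos (weightedSym_transpose σ _) fun x hx => ?_
  set y : ∀ l, {i : Fin N // cl i = l} → ℝ := fun l i => x i
  have hsplit : x ⬝ᵥ weightedSym (diagonal σ) (coupledLaplacian cl c L D) *ᵥ x =
      (∑ l, c l * (y l ⬝ᵥ W l *ᵥ y l)) + x ⬝ᵥ O *ᵥ x := by
    have h1 : ∀ l, c l * (y l ⬝ᵥ W l *ᵥ y l) = ∑ i : {i : Fin N // cl i = l},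
        ∑ j, if cl i = cl j then
          c (cl i) * (x i * (σ i * (L + D) i j + (L + D) j i * σ j) * x j) else 0 := by
      intro l
      rw [dotProduct_mulVec_eq_sum, Finset.mul_sum]
      refine Finset.sum_congr rfl fun i _ => ?_
      rw [Finset.mul_sum, ← Finset.sum_filter]
      have h2 := Finset.sum_subtype (F := inferInstance) (p := fun j => cl j = l)
        (Finset.univ.filter fun j => cl i = cl j)
        (fun j => by simp [i.2, eq_comm]) fun j =>
          c (cl i) * (x i * (σ i * (L + D) i j + (L + D) j i * σ j) * x j)
      rw [h2]
      refine Finset.sum_congr rfl fun j _ => ?_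
      rw [hWapply, i.2]
    simp only [h1]
    rw [Fintype.sum_fiberwise cl fun i => ∑ j, if cl i = cl j then
          c (cl i) * (x i * (σ i * (L + D) i j + (L + D) j i * σ j) * x j) else 0,
      dotProduct_mulVec_eq_sum, dotProduct_mulVec_eq_sum, ← Finset.sum_add_distrib]
    refine Finset.sum_congr rfl fun i _ => ?_
    rw [← Finset.sum_add_distrib]
    refine Finset.sum_congr rfl fun j _ => ?_
    rw [hO]
    simp only [weightedSym_diagonal_apply, coupledLaplacian, coupling, offBlock, of_apply,
      Matrix.add_apply]
    by_cases hij : cl i = cl j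
    · simp only [hij, if_true]
      ring
    · have h3 := hDdiag i j fun h => hij (h ▸ rfl)
      have h4 := hDdiag j i fun h => hij (h ▸ rfl)
      simp only [hij, Ne.symm hij, if_false, h3, h4]
      ring
  have hxx : x ⬝ᵥ x = ∑ l, y l ⬝ᵥ y l := (Fintype.sum_fiberwise cl fun i => x i * x i).symm
  have hynn : ∀ l, 0 ≤ y l ⬝ᵥ y l := fun l => Finset.sum_nonneg fun i _ => mul_self_nonneg _
  calc 0 < ∑ l, (c l * minEigenvalue (W l) + minEigenvalue O) * (y l ⬝ᵥ y l) := by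
        obtain ⟨i, hi⟩ : ∃ i, x i ≠ 0 := Function.ne_iff.1 hx
        refine Finset.sum_pos' (fun l _ => mul_nonneg (hcW l).le (hynn l))
          ⟨cl i, Finset.mem_univ _, mul_pos (hcW _) ?_⟩
        exact Finset.sum_pos' (fun j _ => mul_self_nonneg _)
          ⟨⟨i, rfl⟩, Finset.mem_univ _, mul_self_pos.2 hi⟩
    _ = (∑ l, c l * (minEigenvalue (W l) * (y l ⬝ᵥ y l))) + minEigenvalue O * (x ⬝ᵥ x) := by
        rw [hxx, Finset.mul_sum, ← Finset.sum_add_distrib]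
        exact Finset.sum_congr rfl fun l _ => by ring
    _ ≤ (∑ l, c l * (y l ⬝ᵥ W l *ᵥ y l)) + x ⬝ᵥ O *ᵥ x := by
        refine add_le_add (Finset.sum_le_sum fun l _ => mul_le_mul_of_nonneg_left ?_ (hc0 l))
          (minEigenvalue_mul_le (weightedSym_transpose σ _) x)
        exact minEigenvalue_mul_le (posDef_transpose_eq (hWpd l)) _
    _ = _ := hsplit.symm

/-! ### The Lyapunov inequality of a Hurwitz matrix -/

/-- The powers of an element of spectral radius less than one tend to zero, by Gelfand's formula. -/
lemma tendsto_pow_of_spectralRadius_lt_one {A : Type*} [NormedRing A] [NormedAlgebra ℂ A]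
    [CompleteSpace A] {a : A} (ha : spectralRadius ℂ a < 1) :
    Tendsto (fun k : ℕ => a ^ k) atTop (𝓝 0) := by
  obtain ⟨r, har, hr1⟩ := ENNReal.lt_iff_exists_nnreal_btwn.1 ha
  have hr1 : r < 1 := by exact_mod_cast hr1
  refine squeeze_zero_norm' ?_ (tendsto_pow_atTop_nhds_zero_of_lt_one r.2
    (show (r : ℝ) < 1 from hr1))
  filter_upwards [(spectrum.pow_nnnorm_pow_one_div_tendsto_nhds_spectralRadius a).eventually_lt_const
    har, eventually_gt_atTop 0] with k hk hk0
  have hk' : (0 : ℝ) < k := by exact_mod_cast hk0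
  have h1 : (‖a ^ k‖₊ : ENNReal) ≤ (r : ENNReal) ^ (k : ℝ) := by
    have h := ENNReal.rpow_le_rpow hk.le hk'.le
    rwa [← ENNReal.rpow_mul, one_div, inv_mul_cancel₀ hk'.ne', ENNReal.rpow_one] at h
  rw [ENNReal.rpow_natCast] at h1
  exact_mod_cast h1

section Lyapunov

attribute [local instance] Matrix.linftyOpNormedRing Matrix.linftyOpNormedAlgebra

/-- An explicit Euler step of a Hurwitz system is a discrete-time stable matrix if the step is
small: `|1 + h μ|² = 1 + h (2 Re μ + h |μ|²)`. -/
lemma exists_tendsto_pow_one_add_smul {n : ℕ} {M : Matrix (Fin n) (Fin n) ℝ} (hM : IsHurwitz M) :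
    ∃ h : ℝ, 0 < h ∧ Tendsto (fun k : ℕ => (1 + h • M) ^ k) atTop (𝓝 0) := by
  rcases Nat.eq_zero_or_pos n with rfl | hn
  · refine ⟨1, one_pos, ?_⟩
    simp only [Subsingleton.elim _ (0 : Matrix (Fin 0) (Fin 0) ℝ)]
    exact tendsto_const_nhds
  have : Nonempty (Fin n) := ⟨⟨0, hn⟩⟩
  set f : ℝ →+* ℂ := Complex.ofRealHom
  set Mc : Matrix (Fin n) (Fin n) ℂ := f.mapMatrix M with hMc
  have hev : ∀ᶠ h : ℝ in 𝓝[>] 0, ∀ μ ∈ spectrum ℂ Mc, ‖1 + h * μ‖ < 1 := by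
    refine (Filter.eventually_all_finite (finite_spectrum Mc)).2 fun μ hμ => ?_
    have hre : μ.re < 0 := hM μ hμ
    have hcont : Tendsto (fun h : ℝ => 2 * μ.re + h * Complex.normSq μ) (𝓝[>] 0)
        (𝓝 (2 * μ.re + 0 * Complex.normSq μ)) :=
      Tendsto.mono_left (Continuous.tendsto (by fun_prop) _) nhdsWithin_le_nhds
    filter_upwards [hcont.eventually_lt_const (by linarith : 2 * μ.re + 0 * Complex.normSq μ < 0),
      self_mem_nhdsWithin] with h hh (hpos : 0 < h)
    have h1 : ‖1 + h * μ‖ ^ 2 = 1 + h * (2 * μ.re + h * Complex.normSq μ) := by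
      rw [← Complex.normSq_eq_norm_sq, Complex.normSq_apply, Complex.normSq_apply]
      simp
      ring
    have h2 : ‖1 + h * μ‖ ^ 2 < 1 := by nlinarith
    exact (sq_lt_one_iff₀ (norm_nonneg _)).1 h2
  obtain ⟨h, hspec, hpos : 0 < h⟩ := (hev.and self_mem_nhdsWithin).exists
  refine ⟨h, hpos, ?_⟩
  set T : Matrix (Fin n) (Fin n) ℂ := f.mapMatrix (1 + h • M) with hT
  have hTaeval : T = Polynomial.aeval Mc (1 + Polynomial.C (h : ℂ) * Polynomial.X) := by
    rw [map_add, map_mul, map_one, Polynomial.aeval_C, Polynomial.aeval_X, hT, map_add, map_one,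
      Algebra.algebraMap_eq_smul_one, smul_one_mul]
    congr 1
    ext i j
    simp [hMc, f]
  have hrad : spectralRadius ℂ T < 1 := by
    refine spectrum.spectralRadius_lt_of_forall_lt T (r := 1) fun k hk => ?_
    rw [hTaeval, spectrum.map_polynomial_aeval] at hk
    obtain ⟨μ, hμ, rfl⟩ := hk
    have := hspec μ hμ
    simpa [← NNReal.coe_lt_coe] using this
  have hlim := tendsto_pow_of_spectralRadius_lt_one hrad
  refine tendsto_pi_nhds.2 fun i => tendsto_pi_nhds.2 fun j => ?_
  have hlim' : Tendsto (fun k : ℕ => ((T ^ k) i j).re) atTop (𝓝 0) :=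
    (Complex.continuous_re.tendsto _).comp (tendsto_pi_nhds.1 (tendsto_pi_nhds.1 hlim i) j)
  refine hlim'.congr fun k => ?_
  rw [hT, ← map_pow]
  simp [f]

end Lyapunov

/-- With the Euler step `T = 1 + h M` and `Q = ∑_{k ≤ K} Tᵏ (Tᵏ)ᵀ`, the identity
`T Q Tᵀ = Q - 1 + T^(K+1) (T^(K+1))ᵀ` gives
`-(M Q + Q Mᵀ) = h⁻¹ (1 - T^(K+1) (T^(K+1))ᵀ) + h M Q Mᵀ`. -/
theorem exists_lyapunov {n : ℕ} {M : Matrix (Fin n) (Fin n) ℝ} (hM : IsHurwitz M) :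
    ∃ Q : Matrix (Fin n) (Fin n) ℝ, Q.PosDef ∧ (-(M * Q + Q * Mᵀ)).PosDef := by
  obtain ⟨h, hpos, hlim⟩ := exists_tendsto_pow_one_add_smul hM
  set T := 1 + h • M with hT
  set G := fun k : ℕ => T ^ k * (T ^ k)ᵀ with hG
  have hGpsd : ∀ k, (G k).PosSemidef := fun k => by
    simpa [G] using posSemidef_self_mul_conjTranspose (T ^ k)
  have hGlim : Tendsto (fun k => ∑ i, ∑ j, |G k i j|) atTop (𝓝 0) := by
    have hcont : Continuous fun X : Matrix (Fin n) (Fin n) ℝ => ∑ i, ∑ j, |(X * Xᵀ) i j| := by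
      refine continuous_finsetSum _ fun i _ => continuous_finsetSum _ fun j _ => ?_
      exact ((continuous_id.matrix_mul continuous_id.matrix_transpose).matrix_elem i j).abs
    simpa [G, Function.comp_def] using (hcont.tendsto 0).comp hlim
  obtain ⟨K, hK⟩ : ∃ K, ∑ i, ∑ j, |G (K + 1) i j| < 1 :=
    ((hGlim.comp (tendsto_add_atTop_nat 1)).eventually_lt_const one_pos).exists
  have hGpd : (1 - G (K + 1)).PosDef := by
    refine posDef_of_pos (by simp [G]) fun v hv => ?_
    have h1 := (le_abs_self _).trans (abs_dotProduct_mulVec_le (G (K + 1)) v v)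
    have h2 : ‖v‖ ^ 2 ≤ v ⬝ᵥ v := by
      have hle : ‖v‖ ≤ √(v ⬝ᵥ v) := by
        refine (pi_norm_le_iff_of_nonneg (Real.sqrt_nonneg _)).2 fun i => Real.abs_le_sqrt ?_
        rw [sq]
        exact Finset.single_le_sum (f := fun i => v i * v i) (fun i _ => mul_self_nonneg _)
          (Finset.mem_univ i)
      calc ‖v‖ ^ 2 ≤ √(v ⬝ᵥ v) ^ 2 := by gcongr
        _ = v ⬝ᵥ v := Real.sq_sqrt (Finset.sum_nonneg fun i _ => mul_self_nonneg _)
    have hv2 : 0 < ‖v‖ ^ 2 := pow_pos (norm_pos_iff.2 hv) 2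
    rw [sub_mulVec, one_mulVec, dotProduct_sub]
    nlinarith
  set Q := ∑ k ∈ Finset.range (K + 1), G k with hQ
  have hQpd : Q.PosDef := by
    rw [hQ, Finset.sum_range_succ']
    refine PosDef.posSemidef_add (posSemidef_sum _ fun k _ => hGpsd _) ?_
    simpa [G] using PosDef.one
  have hstep : T * Q * Tᵀ = Q - 1 + G (K + 1) := by
    have h1 : T * Q * Tᵀ = ∑ k ∈ Finset.range (K + 1), G (k + 1) := by
      rw [hQ, Finset.mul_sum, Finset.sum_mul]
      refine Finset.sum_congr rfl fun k _ => ?_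
      simp only [G, pow_succ', transpose_mul, Matrix.mul_assoc]
    have h2 := Finset.sum_range_succ G (K + 1)
    have h3 := Finset.sum_range_succ' G (K + 1)
    have h4 : G 0 = 1 := by simp [G]
    rw [h1, sub_add_eq_add_sub, hQ, ← h2, h3, h4, add_sub_cancel_right]
  refine ⟨Q, hQpd, ?_⟩
  have hMQ : (M * Q * Mᵀ).PosSemidef := by
    simpa using hQpd.posSemidef.mul_mul_conjTranspose_same M
  have hid : -(M * Q + Q * Mᵀ) = h⁻¹ • (1 - G (K + 1)) + h • (M * Q * Mᵀ) := by
    have h1 : 1 - G (K + 1) = -(h • (M * Q + Q * Mᵀ)) - h • h • (M * Q * Mᵀ) := by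
      have h2 : 1 - G (K + 1) = Q - T * Q * Tᵀ := by rw [hstep]; abel
      rw [h2, hT]
      simp only [transpose_add, transpose_one, transpose_smul, Matrix.add_mul, Matrix.mul_add,
        Matrix.one_mul, Matrix.mul_one, Matrix.smul_mul, Matrix.mul_smul, smul_add]
      abel
    rw [h1, smul_sub, smul_neg, inv_smul_smul₀ hpos.ne', inv_smul_smul₀ hpos.ne']
    abel
  rw [hid]
  exact (hGpd.smul (inv_pos.2 hpos)).add_posSemidef (hMQ.smul hpos.le)

/-! ### The gain design -/

/-- If `A + B F` has the Lyapunov inequality `W = -((A + B F) Q + Q (A + B F)ᵀ) > 0`, then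
`P = (k Q)⁻¹` solves the Riccati inequality once `ξ` and then `k` are small: with `R = k Q`, the
conjugate of the inequality by `R` is
`k (W - ξ Q - (k / ξ) Q Fᵀ F Q) + ξ⁻¹ (ξ B + R Fᵀ) (ξ B + R Fᵀ)ᵀ ≥ 0`. -/
theorem exists_riccati {n m : ℕ} {A : Matrix (Fin n) (Fin n) ℝ} {B : Matrix (Fin n) (Fin m) ℝ}
    (hAB : Stabilizable A B) :
    ∃ δ : ℝ, 0 < δ ∧ ∀ ξ, 0 < ξ → ξ ≤ δ → ∃ P : Matrix (Fin n) (Fin n) ℝ, P.PosDef ∧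
      (-(ξ • P) - (P * A + Aᵀ * P - ξ • (P * B * Bᵀ * P))).PosSemidef := by
  obtain ⟨F, hF⟩ := hAB
  obtain ⟨Q, hQ, hW⟩ := exists_lyapunov hF
  have hQt := posDef_transpose_eq hQ
  set W := -((A + B * F) * Q + Q * (A + B * F)ᵀ) with hWdef
  obtain ⟨δ, hδ, hWQ⟩ := exists_posDef_sub_smul hW hQt
  refine ⟨δ, hδ, fun ξ hξ hξδ => ?_⟩
  obtain ⟨k', hk', hpd⟩ := exists_posDef_sub_smul (hWQ ξ hξ.le hξδ) (T := Q * Fᵀ * F * Q)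
    (by simp [transpose_mul, hQt, Matrix.mul_assoc])
  set k := ξ * k' with hk
  have hkpos : 0 < k := mul_pos hξ hk'
  set R := k • Q with hR
  have hRpd : R.PosDef := hQ.smul hkpos
  have hRt := posDef_transpose_eq hRpd
  have hRdet : IsUnit R.det := (isUnit_iff_isUnit_det R).1 hRpd.isUnit
  have hPt := posDef_transpose_eq hRpd.inv
  refine ⟨R⁻¹, hRpd.inv, ?_⟩
  set P := R⁻¹ with hP
  have hPR : P * R = 1 := nonsing_inv_mul _ hRdet
  have hRP : R * P = 1 := mul_nonsing_inv _ hRdet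
  set Y := -(ξ • R) - (A * R + R * Aᵀ - ξ • (B * Bᵀ)) with hY
  have hconj : -(ξ • P) - (P * A + Aᵀ * P - ξ • (P * B * Bᵀ * P)) = P * Y * Pᵀ := by
    have h1 : P * (A * R) * P = P * A := by
      rw [Matrix.mul_assoc, Matrix.mul_assoc, hRP, Matrix.mul_one]
    have h2 : P * (R * Aᵀ) * P = Aᵀ * P := by
      rw [← Matrix.mul_assoc, hPR, Matrix.one_mul]
    rw [hPt, hY]
    simp only [Matrix.mul_sub, Matrix.sub_mul, Matrix.mul_add, Matrix.add_mul, Matrix.mul_neg,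
      Matrix.neg_mul, Matrix.mul_smul, Matrix.smul_mul, h1, h2, hPR, Matrix.one_mul,
      Matrix.mul_assoc]
  have hYeq : Y = k • (W - ξ • Q - k' • (Q * Fᵀ * F * Q)) +
      ξ⁻¹ • ((ξ • B + R * Fᵀ) * (ξ • B + R * Fᵀ)ᵀ) := by
    have h1 : ξ⁻¹ • ((ξ • B + R * Fᵀ) * (ξ • B + R * Fᵀ)ᵀ) =
        ξ • (B * Bᵀ) + B * F * R + R * Fᵀ * Bᵀ + (k * k') • (Q * Fᵀ * F * Q) := by
      have h2 : k * k' = ξ⁻¹ * (k * k) := by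
        rw [hk]
        field_simp
      rw [h2]
      simp only [transpose_add, transpose_smul, transpose_mul, transpose_transpose,
        Matrix.mul_add, Matrix.add_mul, Matrix.mul_smul, Matrix.smul_mul, smul_add,
        inv_smul_smul₀ hξ.ne', hR, Matrix.mul_assoc, hQt, mul_smul,
        smul_comm k ξ]
      abel
    rw [h1, hY, hWdef, hR]
    simp only [transpose_add, transpose_mul, Matrix.mul_add, Matrix.add_mul, Matrix.mul_smul,
      Matrix.smul_mul, smul_sub, smul_add, smul_neg, mul_smul, Matrix.mul_assoc, smul_comm ξ k]
    abel
  rw [hconj]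
  have hYpsd : Y.PosSemidef := by
    rw [hYeq]
    refine ((hpd k' hk'.le le_rfl).smul hkpos).posSemidef.add (PosSemidef.smul ?_ (inv_pos.2 hξ).le)
    simpa using posSemidef_self_mul_conjTranspose (ξ • B + R * Fᵀ)
  simpa using hYpsd.mul_mul_conjTranspose_same P

theorem exists_isGainDesign {n m N : ℕ} {A : Matrix (Fin n) (Fin n) ℝ}
    {B : Matrix (Fin n) (Fin m) ℝ} (hAB : Stabilizable A B) {Lc : Matrix (Fin N) (Fin N) ℝ}
    {σ : Fin N → ℝ} (hLc : (weightedSym (diagonal σ) Lc).PosDef) :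
    ∃ P, IsGainDesign A B Lc σ P := by
  obtain ⟨δ₁, hδ₁, h₁⟩ := exists_posDef_sub_smul hLc (diagonal_transpose σ)
  obtain ⟨δ₂, hδ₂, h₂⟩ := exists_riccati hAB
  have hmin : 0 < min δ₁ δ₂ := lt_min hδ₁ hδ₂
  obtain ⟨P, hP, hric⟩ := h₂ _ hmin (min_le_right _ _)
  exact ⟨P, hP, _, hmin, h₁ _ hmin.le (min_le_left _ _), hric⟩

/-! ### Uniform means -/

/-- A measurable function, bounded on `[0, ∞)`, whose means over `[a, a + t]` converge to `m` as
`t → ∞`, uniformly in `a ≥ 0`. -/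
structure HasUniformMean (f : ℝ → ℝ) (m : ℝ) : Prop where
  measurable : Measurable f
  bounded : ∃ C : ℝ, ∀ t, 0 ≤ t → |f t| ≤ C
  mean : ∀ δ > 0, ∃ T > 0, ∀ a t : ℝ, 0 ≤ a → T ≤ t →
    |(∫ τ in a..(a + t), f τ) - t * m| ≤ δ * t

/-- A bounded measurable coefficient times a continuous function is integrable. -/
lemma intervalIntegrable_mul_continuousOn {f g : ℝ → ℝ} (hf : Measurable f) {C a b : ℝ}
    (hab : a ≤ b) (hC : ∀ t, a ≤ t → |f t| ≤ C) (hg : ContinuousOn g (Icc a b)) :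
    IntervalIntegrable (fun t => f t * g t) MeasureTheory.volume a b := by
  have hg' : IntervalIntegrable g MeasureTheory.volume a b :=
    ContinuousOn.intervalIntegrable (by rwa [uIcc_of_le hab])
  rw [intervalIntegrable_iff] at hg' ⊢
  refine hg'.bdd_mul (c := C) hf.aestronglyMeasurable ?_
  refine (MeasureTheory.ae_restrict_iff' measurableSet_uIoc).2 (Eventually.of_forall fun t ht => ?_)
  rw [uIoc_of_le hab] at ht
  exact hC t ht.1.le

namespace HasUniformMean

variable {f g : ℝ → ℝ} {m m' : ℝ}

lemma intervalIntegrable (hf : HasUniformMean f m) {a b : ℝ} (ha : 0 ≤ a) (hab : a ≤ b) :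
    IntervalIntegrable f MeasureTheory.volume a b := by
  obtain ⟨C, hC⟩ := hf.bounded
  simpa using intervalIntegrable_mul_continuousOn hf.measurable hab
    (fun t ht => hC t (ha.trans ht)) (continuousOn_const (c := (1 : ℝ)))

lemma const (m : ℝ) : HasUniformMean (fun _ => m) m where
  measurable := measurable_const
  bounded := ⟨|m|, fun _ _ => le_rfl⟩
  mean δ hδ := ⟨1, one_pos, fun a t _ ht => by
    simp only [intervalIntegral.integral_const, smul_eq_mul, add_sub_cancel_left, sub_self,
      abs_zero]
    positivity⟩

lemma add (hf : HasUniformMean f m) (hg : HasUniformMean g m') :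
    HasUniformMean (fun t => f t + g t) (m + m') where
  measurable := hf.measurable.add hg.measurable
  bounded := by
    obtain ⟨C, hC⟩ := hf.bounded
    obtain ⟨C', hC'⟩ := hg.bounded
    exact ⟨C + C', fun t ht => (abs_add_le _ _).trans (add_le_add (hC t ht) (hC' t ht))⟩
  mean δ hδ := by
    obtain ⟨T, hT, h⟩ := hf.mean (δ / 2) (half_pos hδ)
    obtain ⟨T', hT', h'⟩ := hg.mean (δ / 2) (half_pos hδ)
    refine ⟨max T T', lt_max_of_lt_left hT, fun a t ha ht => ?_⟩
    have h1 := h a t ha ((le_max_left _ _).trans ht)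
    have h2 := h' a t ha ((le_max_right _ _).trans ht)
    have ht0 : 0 ≤ t := hT.le.trans ((le_max_left _ _).trans ht)
    rw [intervalIntegral.integral_add (hf.intervalIntegrable ha (by linarith))
      (hg.intervalIntegrable ha (by linarith))]
    calc _ = |((∫ τ in a..(a + t), f τ) - t * m) + ((∫ τ in a..(a + t), g τ) - t * m')| := by
          congr 1; ring
      _ ≤ δ / 2 * t + δ / 2 * t := (abs_add_le _ _).trans (add_le_add h1 h2)
      _ = δ * t := by ring

lemma const_mul (hf : HasUniformMean f m) (r : ℝ) : HasUniformMean (fun t => r * f t) (r * m) where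
  measurable := hf.measurable.const_mul r
  bounded := by
    obtain ⟨C, hC⟩ := hf.bounded
    exact ⟨|r| * C, fun t ht => by
      rw [abs_mul]
      exact mul_le_mul_of_nonneg_left (hC t ht) (abs_nonneg r)⟩
  mean δ hδ := by
    obtain ⟨T, hT, h⟩ := hf.mean (δ / (|r| + 1)) (by positivity)
    refine ⟨T, hT, fun a t ha ht => ?_⟩
    have ht0 : 0 ≤ t := hT.le.trans ht
    rw [intervalIntegral.integral_const_mul]
    calc _ = |r| * |(∫ τ in a..(a + t), f τ) - t * m| := by rw [← abs_mul]; congr 1; ring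
      _ ≤ (|r| + 1) * (δ / (|r| + 1) * t) := by
          gcongr
          · linarith
          · exact h a t ha ht
      _ = δ * t := by field_simp

/-- In the fast time scale `s / ε`, the integrals over intervals of a fixed length `h` are close to
`h m`. -/
lemma exists_abs_integral_comp_div_sub_le (hf : HasUniformMean f m) {δ h : ℝ} (hδ : 0 < δ)
    (hh : 0 < h) : ∃ ε₀ > 0, ∀ ε, 0 < ε → ε < ε₀ → ∀ a, 0 ≤ a →
      |(∫ s in a..(a + h), f (s / ε)) - h * m| ≤ δ * h := by
  obtain ⟨T, hT, hmean⟩ := hf.mean δ hδ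
  refine ⟨h / T, div_pos hh hT, fun ε hε hlt a ha => ?_⟩
  have h1 := hmean (a / ε) (h / ε) (div_nonneg ha hε.le)
    ((le_div_iff₀ hε).2 (by have := (lt_div_iff₀ hT).1 hlt; linarith))
  rw [intervalIntegral.integral_comp_div _ hε.ne', add_div, smul_eq_mul]
  calc _ = ε * |(∫ s in (a / ε)..(a / ε + h / ε), f s) - h / ε * m| := by
        rw [← abs_of_pos hε, ← abs_mul, abs_of_pos hε]
        congr 1
        field_simp
    _ ≤ ε * (δ * (h / ε)) := by gcongr
    _ = δ * h := by field_simp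

end HasUniformMean

lemma HasAverage.hasUniformMean {N : ℕ} {L : ℝ → Matrix (Fin N) (Fin N) ℝ}
    {Linf : Matrix (Fin N) (Fin N) ℝ} (h : HasAverage L Linf) (i j : Fin N) :
    HasUniformMean (fun t => L t i j) (Linf i j) where
  measurable := h.measurable i j
  bounded := by
    obtain ⟨C, hC⟩ := h.bounded
    exact ⟨C, fun t ht => hC t ht i j⟩
  mean δ hδ := by
    obtain ⟨κ, β, -, -, hlim, havg⟩ := h.average
    have hlim' : Tendsto (fun t => κ * β t) atTop (𝓝 0) := by simpa using hlim.const_mul κ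
    obtain ⟨T, hT⟩ := eventually_atTop.1 (hlim'.eventually_lt_const hδ)
    refine ⟨max T 1, by positivity, fun a t ha ht => ?_⟩
    have ht0 : 0 < t := one_pos.trans_le ((le_max_right _ _).trans ht)
    have h1 := (havg a t ha ht0 i j).trans (hT t ((le_max_left _ _).trans ht)).le
    calc _ = |t * (1 / t * (∫ τ in a..(a + t), L τ i j) - Linf i j)| := by
          congr 1
          field_simp
      _ = |1 / t * (∫ τ in a..(a + t), L τ i j) - Linf i j| * t := by
          rw [abs_mul, abs_of_pos ht0, mul_comm]
      _ ≤ δ * t := by gcongr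

lemma HasUniformMean.unique {f : ℝ → ℝ} {m m' : ℝ} (h : HasUniformMean f m)
    (h' : HasUniformMean f m') : m = m' := by
  refine eq_of_forall_dist_le fun δ hδ => ?_
  obtain ⟨T, hT, h1⟩ := h.mean (δ / 2) (half_pos hδ)
  obtain ⟨T', -, h2⟩ := h'.mean (δ / 2) (half_pos hδ)
  set t := max T T'
  have ht : 0 < t := lt_max_of_lt_left hT
  have h3 := h1 0 t le_rfl (le_max_left _ _)
  have h4 := h2 0 t le_rfl (le_max_right _ _)
  refine le_of_mul_le_mul_right ?_ ht
  rw [abs_sub_comm] at h3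
  calc dist m m' * t = |t * m - t * m'| := by
        rw [Real.dist_eq, ← mul_sub, abs_mul, abs_of_pos ht, mul_comm]
    _ ≤ _ := abs_sub_le _ (∫ τ in (0 : ℝ)..(0 + t), f τ) _
    _ ≤ δ / 2 * t + δ / 2 * t := add_le_add h3 h4
    _ = δ * t := by ring

lemma HasUniformMean.sum {ι : Type*} (s : Finset ι) {f : ι → ℝ → ℝ} {m : ι → ℝ}
    (h : ∀ i ∈ s, HasUniformMean (f i) (m i)) :
    HasUniformMean (fun t => ∑ i ∈ s, f i t) (∑ i ∈ s, m i) := by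
  classical
  induction s using Finset.induction_on with
  | empty => simpa using HasUniformMean.const 0
  | insert i s hi ih =>
    simp only [Finset.sum_insert hi]
    exact (h i (Finset.mem_insert_self i s)).add
      (ih fun j hj => h j (Finset.mem_insert_of_mem hj))

lemma HasUniformMean.congr_nonneg {f g : ℝ → ℝ} {m : ℝ} (h : HasUniformMean f m)
    (hg : Measurable g) (hfg : ∀ t, 0 ≤ t → g t = f t) : HasUniformMean g m where
  measurable := hg
  bounded := by
    obtain ⟨C, hC⟩ := h.bounded
    exact ⟨C, fun t ht => hfg t ht ▸ hC t ht⟩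
  mean δ hδ := by
    obtain ⟨T, hT, hm⟩ := h.mean δ hδ
    refine ⟨T, hT, fun a t ha ht => ?_⟩
    rw [intervalIntegral.integral_congr (g := f) fun τ hτ => hfg τ ?_]
    · exact hm a t ha ht
    · rw [uIcc_of_le (by linarith)] at hτ
      exact ha.trans hτ.1

/-! ### Averaging of fast linear systems -/

section Averaging

variable {ι : Type*} [Fintype ι]

/-- `e` solves `e' = M e` on `[t₀, ∞)` in the sense of Carathéodory. -/
structure IsLinearSolution (M : ℝ → Matrix ι ι ℝ) (t₀ : ℝ) (e : ℝ → ι → ℝ) : Prop where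
  continuousOn : ContinuousOn e (Ici t₀)
  eq : ∀ i t, t₀ ≤ t → e t i = e t₀ i + ∫ s in t₀..t, ∑ j, M s i j * e s j

variable {M : ℝ → Matrix ι ι ℝ} {t₀ C : ℝ} {e : ℝ → ι → ℝ}

lemma IsLinearSolution.intervalIntegrable_mul (he : IsLinearSolution M t₀ e)
    (hM : ∀ i j, Measurable fun t => M t i j)
    (hC : ∀ t, t₀ ≤ t → ∀ i j, |M t i j| ≤ C) {a b : ℝ} (ha : t₀ ≤ a) (hab : a ≤ b) (i j : ι) :
    IntervalIntegrable (fun s => M s i j * e s j) MeasureTheory.volume a b :=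
  intervalIntegrable_mul_continuousOn (hM i j) hab (fun t ht => hC t (ha.trans ht) i j)
    (((continuous_apply j).comp_continuousOn he.continuousOn).mono fun _ hs => ha.trans hs.1)

lemma IsLinearSolution.sub_eq (he : IsLinearSolution M t₀ e)
    (hM : ∀ i j, Measurable fun t => M t i j) (hC : ∀ t, t₀ ≤ t → ∀ i j, |M t i j| ≤ C) {a b : ℝ}
    (ha : t₀ ≤ a) (hab : a ≤ b) (i : ι) :
    e b i - e a i = ∫ s in a..b, ∑ j, M s i j * e s j := by
  have hint : ∀ {a b : ℝ}, t₀ ≤ a → a ≤ b →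
      IntervalIntegrable (fun s => ∑ j, M s i j * e s j) MeasureTheory.volume a b :=
    fun ha hab => by
      simpa only [← Finset.sum_fn] using IntervalIntegrable.sum Finset.univ
        fun j _ => he.intervalIntegrable_mul hM hC ha hab i j
  rw [he.eq i b (ha.trans hab), he.eq i a ha,
    ← intervalIntegral.integral_add_adjacent_intervals (hint le_rfl ha) (hint ha hab)]
  ring

/-- On an interval of length `h ≤ 1 / (2 K)`, where `K` bounds the norm of the coefficients, the
maximum `S` of `‖e‖` satisfies `S ≤ ‖e a‖ + K h S`. -/
lemma IsLinearSolution.norm_bounds (he : IsLinearSolution M t₀ e)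
    (hM : ∀ i j, Measurable fun t => M t i j) (hC : ∀ t, t₀ ≤ t → ∀ i j, |M t i j| ≤ C) {K : ℝ}
    (hK : 0 < K) (hCK : Fintype.card ι * C ≤ K) {a h : ℝ} (ha : t₀ ≤ a) (hh : 0 ≤ h)
    (hKh : K * h ≤ 1 / 2) {b : ℝ} (hb : b ∈ Icc a (a + h)) :
    ‖e b‖ ≤ 2 * ‖e a‖ ∧ ‖e b - e a‖ ≤ 2 * K * h * ‖e a‖ := by
  obtain ⟨c, hc, hmax⟩ := isCompact_Icc.exists_isMaxOn (nonempty_Icc.2 (by linarith : a ≤ a + h))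
    (he.continuousOn.norm.mono fun s hs => ha.trans hs.1)
  have hmax : ∀ s ∈ Icc a (a + h), ‖e s‖ ≤ ‖e c‖ := fun s hs => hmax hs
  have hdiff : ∀ b ∈ Icc a (a + h), ‖e b - e a‖ ≤ K * h * ‖e c‖ := by
    intro b hb
    refine (pi_norm_le_iff_of_nonneg (by positivity)).2 fun i => ?_
    rw [Pi.sub_apply, he.sub_eq hM hC ha hb.1]
    refine (intervalIntegral.norm_integral_le_of_norm_le_const (C := K * ‖e c‖) fun s hs => ?_).trans
      ?_
    · rw [uIoc_of_le hb.1] at hs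
      have hs' : s ∈ Icc a (a + h) := ⟨hs.1.le, hs.2.trans hb.2⟩
      calc ‖∑ j, M s i j * e s j‖ ≤ ∑ _j : ι, C * ‖e c‖ := by
            refine norm_sum_le_of_le _ fun j _ => ?_
            rw [norm_mul]
            exact mul_le_mul (hC s (ha.trans hs'.1) i j)
              ((norm_le_pi_norm _ _).trans (hmax s hs')) (norm_nonneg _)
              ((abs_nonneg _).trans (hC s (ha.trans hs'.1) i j))
        _ = Fintype.card ι * C * ‖e c‖ := by simp [mul_assoc]
        _ ≤ K * ‖e c‖ := by gcongr
    · rw [abs_of_nonneg (by linarith [hb.1])]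
      calc K * ‖e c‖ * (b - a) ≤ K * ‖e c‖ * h := by
            gcongr
            linarith [hb.2]
        _ = K * h * ‖e c‖ := by ring
  have hc2 : ‖e c‖ ≤ 2 * ‖e a‖ := by
    have h1 := hdiff c hc
    have h2 := norm_sub_norm_le (e c) (e a)
    nlinarith [norm_nonneg (e c)]
  refine ⟨(hmax b hb).trans hc2, (hdiff b hb).trans ?_⟩
  calc K * h * ‖e c‖ ≤ K * h * (2 * ‖e a‖) := by gcongr
    _ = 2 * K * h * ‖e a‖ := by ring

/-- Over one step the solution follows the Euler step of the averaged system up to an error of order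
`h² + δ h`, where `δ` measures how far the integrals of the coefficients are from their means. -/
lemma IsLinearSolution.norm_sub_euler_le (he : IsLinearSolution M t₀ e)
    (hM : ∀ i j, Measurable fun t => M t i j) (hC : ∀ t, t₀ ≤ t → ∀ i j, |M t i j| ≤ C) {K : ℝ}
    (hK : 0 < K) (hCK : Fintype.card ι * C ≤ K) {a h δ : ℝ} (ha : t₀ ≤ a) (hh : 0 ≤ h)
    (hKh : K * h ≤ 1 / 2) {Mbar : Matrix ι ι ℝ} (hδ : 0 ≤ δ)
    (hmean : ∀ i j, |(∫ s in a..(a + h), M s i j) - h * Mbar i j| ≤ δ * h) :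
    ‖e (a + h) - e a - h • (Mbar *ᵥ e a)‖ ≤ (2 * K ^ 2 * h + Fintype.card ι * δ) * h * ‖e a‖ := by
  have hah : a ≤ a + h := by linarith
  refine (pi_norm_le_iff_of_nonneg (by positivity)).2 fun i => ?_
  have hint1 : ∀ j, IntervalIntegrable (fun s => M s i j * e s j) MeasureTheory.volume a (a + h) :=
    fun j => he.intervalIntegrable_mul hM hC ha hah i j
  have hint2 : ∀ j, IntervalIntegrable (fun s => M s i j * e a j) MeasureTheory.volume a (a + h) :=
    fun j => intervalIntegrable_mul_continuousOn (hM i j) hah (fun t ht => hC t (ha.trans ht) i j)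
      continuousOn_const
  have hsplit : (e (a + h) - e a - h • (Mbar *ᵥ e a)) i =
      ∑ j, ((∫ s in a..(a + h), M s i j * (e s j - e a j)) +
        ((∫ s in a..(a + h), M s i j) - h * Mbar i j) * e a j) := by
    have h1 : ∀ j, (∫ s in a..(a + h), M s i j * (e s j - e a j)) =
        (∫ s in a..(a + h), M s i j * e s j) - (∫ s in a..(a + h), M s i j) * e a j := fun j => by
      rw [← intervalIntegral.integral_mul_const, ← intervalIntegral.integral_sub (hint1 j) (hint2 j)]
      simp only [mul_sub]
    simp only [Pi.sub_apply, Pi.smul_apply, he.sub_eq hM hC ha hah, smul_eq_mul, mulVec, dotProduct]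
    rw [intervalIntegral.integral_finsetSum fun j _ => hint1 j, Finset.mul_sum,
      ← Finset.sum_sub_distrib]
    exact Finset.sum_congr rfl fun j _ => by rw [h1]; ring
  have hpart : ∀ j, |∫ s in a..(a + h), M s i j * (e s j - e a j)| ≤
      C * (2 * K * h * ‖e a‖) * h := fun j => by
    have := intervalIntegral.norm_integral_le_of_norm_le_const (a := a) (b := a + h)
      (f := fun s => M s i j * (e s j - e a j)) (C := C * (2 * K * h * ‖e a‖)) fun s hs => by
        rw [uIoc_of_le hah] at hs
        rw [norm_mul]
        have hMs := hC s (ha.trans hs.1.le) i j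
        exact mul_le_mul hMs ((norm_le_pi_norm (e s - e a) j).trans
          (he.norm_bounds hM hC hK hCK ha hh hKh ⟨hs.1.le, hs.2⟩).2) (norm_nonneg _)
          ((abs_nonneg _).trans hMs)
    rwa [add_sub_cancel_left, abs_of_nonneg hh] at this
  rw [hsplit]
  calc _ ≤ ∑ _j : ι, (C * (2 * K * h * ‖e a‖) * h + δ * h * ‖e a‖) := by
        refine norm_sum_le_of_le _ fun j _ => (norm_add_le _ _).trans (add_le_add (hpart j) ?_)
        rw [norm_mul]
        exact mul_le_mul (hmean i j) (norm_le_pi_norm _ _) (norm_nonneg _) (by positivity)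
    _ = (Fintype.card ι * C * (2 * K * h) + Fintype.card ι * δ) * h * ‖e a‖ := by
        rw [Finset.sum_const, Finset.card_univ, nsmul_eq_mul]
        ring
    _ ≤ (K * (2 * K * h) + Fintype.card ι * δ) * h * ‖e a‖ := by gcongr
    _ = _ := by ring

/-- If `V v = vᵀ Q v` decreases along the averaged system at rate `ξ`, then one step multiplies it
by at most `1 - h ξ / 2`, provided that `h` and `δ` are small. -/
lemma IsLinearSolution.lyapunov_step (he : IsLinearSolution M t₀ e)
    (hM : ∀ i j, Measurable fun t => M t i j) (hC : ∀ t, t₀ ≤ t → ∀ i j, |M t i j| ≤ C) {K : ℝ}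
    (hK : 0 < K) (hCK : Fintype.card ι * C ≤ K) {Q Mbar : Matrix ι ι ℝ} (hQt : Qᵀ = Q)
    {α b ξ : ℝ} (hlower : ∀ v, α * ‖v‖ ^ 2 ≤ v ⬝ᵥ Q *ᵥ v) (hb : 0 ≤ b)
    (hupper : ∀ v w, |v ⬝ᵥ Q *ᵥ w| ≤ b * ‖v‖ * ‖w‖) (hξ : 0 ≤ ξ)
    (hdec : ∀ v, 2 * (v ⬝ᵥ Q *ᵥ (Mbar *ᵥ v)) ≤ -ξ * (v ⬝ᵥ Q *ᵥ v)) {a h δ : ℝ} (ha : t₀ ≤ a)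
    (hh : 0 ≤ h) (hKh : K * h ≤ 1 / 2) (hδ : 0 ≤ δ)
    (hmean : ∀ i j, |(∫ s in a..(a + h), M s i j) - h * Mbar i j| ≤ δ * h)
    (hsmall : 8 * b * K ^ 2 * h + 2 * b * Fintype.card ι * δ ≤ α * ξ / 2) :
    e (a + h) ⬝ᵥ Q *ᵥ e (a + h) ≤ (1 - h * ξ / 2) * (e a ⬝ᵥ Q *ᵥ e a) := by
  set Δ := e (a + h) - e a with hΔ
  set w := Δ - h • (Mbar *ᵥ e a) with hw
  have hwle : ‖w‖ ≤ (2 * K ^ 2 * h + Fintype.card ι * δ) * h * ‖e a‖ :=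
    he.norm_sub_euler_le hM hC hK hCK ha hh hKh hδ hmean
  have hΔle : ‖Δ‖ ≤ 2 * K * h * ‖e a‖ :=
    (he.norm_bounds hM hC hK hCK ha hh hKh ⟨by linarith, le_rfl⟩).2
  have hsymm : ∀ v w : ι → ℝ, v ⬝ᵥ Q *ᵥ w = w ⬝ᵥ Q *ᵥ v := fun v w => by
    rw [dotProduct_mulVec, ← mulVec_transpose, hQt, dotProduct_comm]
  have hexp : e (a + h) ⬝ᵥ Q *ᵥ e (a + h) = e a ⬝ᵥ Q *ᵥ e a +
      h * (2 * (e a ⬝ᵥ Q *ᵥ (Mbar *ᵥ e a))) + 2 * (e a ⬝ᵥ Q *ᵥ w) + Δ ⬝ᵥ Q *ᵥ Δ := by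
    have h1 : e (a + h) = e a + Δ := by simp [hΔ]
    have h2 : e a ⬝ᵥ Q *ᵥ Δ = h * (e a ⬝ᵥ Q *ᵥ (Mbar *ᵥ e a)) + e a ⬝ᵥ Q *ᵥ w := by
      rw [← smul_eq_mul, ← dotProduct_smul, ← mulVec_smul, ← dotProduct_add, ← mulVec_add, hw,
        add_sub_cancel]
    rw [h1, mulVec_add, dotProduct_add, add_dotProduct, add_dotProduct, hsymm Δ (e a), h2]
    ring
  have h3 : e a ⬝ᵥ Q *ᵥ w ≤ b * ‖e a‖ * ((2 * K ^ 2 * h + Fintype.card ι * δ) * h * ‖e a‖) :=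
    ((le_abs_self _).trans (hupper _ _)).trans (by gcongr)
  have h4 : Δ ⬝ᵥ Q *ᵥ Δ ≤ b * (2 * K * h * ‖e a‖) * (2 * K * h * ‖e a‖) :=
    ((le_abs_self _).trans (hupper _ _)).trans (by gcongr)
  have h5 : h * (2 * (e a ⬝ᵥ Q *ᵥ (Mbar *ᵥ e a))) ≤ h * (-ξ * (e a ⬝ᵥ Q *ᵥ e a)) :=
    mul_le_mul_of_nonneg_left (hdec _) hh
  have h6 : (8 * b * K ^ 2 * h + 2 * b * Fintype.card ι * δ) * (h * ‖e a‖ ^ 2) ≤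
      α * ξ / 2 * (h * ‖e a‖ ^ 2) := by gcongr
  have h7 : ξ / 2 * h * (α * ‖e a‖ ^ 2) ≤ ξ / 2 * h * (e a ⬝ᵥ Q *ᵥ e a) :=
    mul_le_mul_of_nonneg_left (hlower _) (by positivity)
  rw [hexp]
  linarith

/-- Averaging: if the averaged system has a quadratic Lyapunov function, then the system with the
coefficients `M (t / ε)` is exponentially stable, uniformly in the initial time, for all small
`ε`. -/
theorem exists_exponential_decay_of_average {Mbar Q : Matrix ι ι ℝ}
    (hmean : ∀ i j, HasUniformMean (fun t => M t i j) (Mbar i j)) (hQ : Q.PosDef) {ξ : ℝ}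
    (hξ : 0 < ξ) (hdec : ∀ v, 2 * (v ⬝ᵥ Q *ᵥ (Mbar *ᵥ v)) ≤ -ξ * (v ⬝ᵥ Q *ᵥ v)) :
    ∃ ε₀ : ℝ, 0 < ε₀ ∧ ∀ ε, 0 < ε → ε < ε₀ → ∃ B rate : ℝ, 0 < B ∧ 0 < rate ∧
      ∀ t₀ e, 0 ≤ t₀ → IsLinearSolution (fun t => M (t / ε)) t₀ e →
        ∀ t, t₀ ≤ t → ‖e t‖ ≤ B * Real.exp (-rate * (t - t₀)) * ‖e t₀‖ := by
  choose C hC using fun i j => (hmean i j).bounded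
  set C' := ∑ i, ∑ j, |C i j| with hC'
  have hCC' : ∀ t, 0 ≤ t → ∀ i j, |M t i j| ≤ C' := fun t ht i j =>
    ((hC i j t ht).trans (le_abs_self _)).trans <|
      (Finset.single_le_sum (f := fun j => |C i j|) (fun j _ => abs_nonneg _)
        (Finset.mem_univ j)).trans
      (Finset.single_le_sum (f := fun i => ∑ j, |C i j|)
        (fun i _ => Finset.sum_nonneg fun j _ => abs_nonneg _) (Finset.mem_univ i))
  have hC'0 : 0 ≤ C' := Finset.sum_nonneg fun i _ => Finset.sum_nonneg fun j _ => abs_nonneg _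
  set K := Fintype.card ι * C' + 1 with hKdef
  have hK : 0 < K := by positivity
  have hCK : Fintype.card ι * C' ≤ K := by linarith
  obtain ⟨α, hα, hlower⟩ := exists_mul_sq_le_of_posDef hQ
  set b := (∑ i, ∑ j, |Q i j|) + 1 with hb
  have hb0 : 0 < b :=
    add_pos_of_nonneg_of_pos
      (Finset.sum_nonneg fun i _ => Finset.sum_nonneg fun j _ => abs_nonneg _) one_pos
  have hupper : ∀ v w, |v ⬝ᵥ Q *ᵥ w| ≤ b * ‖v‖ * ‖w‖ := fun v w =>
    (abs_dotProduct_mulVec_le Q v w).trans (by gcongr; linarith)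
  -- Half of the decay `α ξ / 2` is left for the error of second order, half for that of the mean.
  set h := min (1 / (2 * K)) (α * ξ / 4 / (8 * b * K ^ 2)) with hh
  have hh0 : 0 < h := by positivity
  have hKh : K * h ≤ 1 / 2 := by
    calc K * h ≤ K * (1 / (2 * K)) := by gcongr; exact min_le_left _ _
      _ = 1 / 2 := by field_simp
  set δ := α * ξ / 4 / (2 * b * Fintype.card ι + 1) with hδ
  have hδ0 : 0 < δ := by positivity
  have hsmall : 8 * b * K ^ 2 * h + 2 * b * Fintype.card ι * δ ≤ α * ξ / 2 := by
    have h1 : 8 * b * K ^ 2 * h ≤ α * ξ / 4 := by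
      rw [mul_comm]
      exact (le_div_iff₀ (by positivity)).1 (min_le_right _ _)
    have h2 : (2 * b * Fintype.card ι + 1) * δ = α * ξ / 4 := by
      rw [hδ]
      field_simp
    linarith
  choose E hE0 hE using fun i j => (hmean i j).exists_abs_integral_comp_div_sub_le hδ0 hh0
  obtain ⟨ε₀, hε₀, hε₀E⟩ : ∃ ε₀ > 0, ∀ i j, ε₀ ≤ E i j := by
    have : ∀ᶠ x in 𝓝[>] (0 : ℝ), ∀ i j, x ≤ E i j :=
      eventually_all.2 fun i => eventually_all.2 fun j =>
        Eventually.mono (nhdsWithin_le_nhds (Iio_mem_nhds (hE0 i j))) fun _ h => le_of_lt h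
    obtain ⟨x, hx, hx0⟩ := (this.and self_mem_nhdsWithin).exists
    exact ⟨x, hx0, hx⟩
  refine ⟨ε₀, hε₀, fun ε hε hlt => ?_⟩
  refine ⟨2 * √(b / α * Real.exp (h * ξ / 2)), ξ / 4, by positivity, by positivity,
    fun t₀ e ht₀ he t ht => ?_⟩
  have hM : ∀ i j, Measurable fun t => M (t / ε) i j := fun i j =>
    (hmean i j).measurable.comp (measurable_id.div_const ε)
  have hCε : ∀ t, t₀ ≤ t → ∀ i j, |M (t / ε) i j| ≤ C' := fun t ht i j =>
    hCC' _ (div_nonneg (ht₀.trans ht) hε.le) i j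
  set V := fun t => e t ⬝ᵥ Q *ᵥ e t with hV
  have hVnonneg : ∀ t, 0 ≤ V t := fun t => posDef_nonneg hQ (e t)
  have hsteps : ∀ k : ℕ, V (t₀ + k * h) ≤ Real.exp (-(k * (h * ξ / 2))) * V t₀ := by
    intro k
    induction k with
    | zero => simp
    | succ k ih =>
      have hak : t₀ ≤ t₀ + k * h := by
        have : 0 ≤ k * h := by positivity
        linarith
      have hstep := he.lyapunov_step hM hCε hK hCK (posDef_transpose_eq hQ) hlower hb0.le hupper
        hξ.le hdec hak hh0.le hKh hδ0.le
        (fun i j => hE i j ε hε (hlt.trans_le (hε₀E i j)) _ (ht₀.trans hak)) hsmall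
      have h1 : 1 - h * ξ / 2 ≤ Real.exp (-(h * ξ / 2)) := by
        have := Real.add_one_le_exp (-(h * ξ / 2))
        linarith
      calc V (t₀ + (k + 1 : ℕ) * h) = V (t₀ + k * h + h) := by
            congr 1
            push_cast
            ring
        _ ≤ (1 - h * ξ / 2) * V (t₀ + k * h) := hstep
        _ ≤ Real.exp (-(h * ξ / 2)) * (Real.exp (-(k * (h * ξ / 2))) * V t₀) :=
            mul_le_mul h1 ih (hVnonneg _) (Real.exp_nonneg _)
        _ = Real.exp (-((k + 1 : ℕ) * (h * ξ / 2))) * V t₀ := by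
            rw [← mul_assoc, ← Real.exp_add]
            congr 2
            push_cast
            ring
  set k := ⌊(t - t₀) / h⌋₊ with hk
  have hk1 : k * h ≤ t - t₀ :=
    (le_div_iff₀ hh0).1 (Nat.floor_le (div_nonneg (sub_nonneg.2 ht) hh0.le))
  have hk2 : t - t₀ < (k + 1) * h := (div_lt_iff₀ hh0).1 (Nat.lt_floor_add_one _)
  have hnorm : ‖e t‖ ≤ 2 * ‖e (t₀ + k * h)‖ :=
    (he.norm_bounds hM hCε hK hCK (a := t₀ + k * h) (by
      have : 0 ≤ k * h := by positivity
      linarith) hh0.le hKh ⟨by linarith, by linarith⟩).1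
  have hsq : ‖e (t₀ + k * h)‖ ^ 2 ≤
      b / α * Real.exp (h * ξ / 2) * (Real.exp (-(ξ / 4) * (t - t₀)) * ‖e t₀‖) ^ 2 := by
    have h1 : α * ‖e (t₀ + k * h)‖ ^ 2 ≤
        Real.exp (h * ξ / 2) * Real.exp (-(ξ / 4) * (t - t₀)) ^ 2 * (b * ‖e t₀‖ ^ 2) := by
      calc α * ‖e (t₀ + k * h)‖ ^ 2 ≤ V (t₀ + k * h) := hlower _
        _ ≤ Real.exp (-(k * (h * ξ / 2))) * V t₀ := hsteps k
        _ ≤ Real.exp (h * ξ / 2 + 2 * (-(ξ / 4) * (t - t₀))) * (b * ‖e t₀‖ ^ 2) := by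
            refine mul_le_mul (Real.exp_le_exp.2 ?_) ?_ (hVnonneg _) (Real.exp_nonneg _)
            · nlinarith
            · have := (le_abs_self _).trans (hupper (e t₀) (e t₀))
              linarith
        _ = _ := by
            rw [Real.exp_add, ← Real.exp_nat_mul]
            norm_num
    rw [← le_div_iff₀' hα] at h1
    refine h1.trans_eq ?_
    ring
  have hroot : ‖e (t₀ + k * h)‖ ≤
      √(b / α * Real.exp (h * ξ / 2)) * (Real.exp (-(ξ / 4) * (t - t₀)) * ‖e t₀‖) := by
    refine le_of_sq_le_sq ?_ (by positivity)
    rwa [mul_pow, Real.sq_sqrt (by positivity)]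
  calc ‖e t‖ ≤ 2 * ‖e (t₀ + k * h)‖ := hnorm
    _ ≤ 2 * (√(b / α * Real.exp (h * ξ / 2)) * (Real.exp (-(ξ / 4) * (t - t₀)) * ‖e t₀‖)) := by
        gcongr
    _ = _ := by ring

end Averaging

/-! ### The averaged Lyapunov function -/

open scoped Kronecker in
/-- The matrix of the stacked error system `e_i' = A e_i - G ∑ⱼ Xᵢⱼ eⱼ`. -/
def errorMatrix {N n : ℕ} (A G : Matrix (Fin n) (Fin n) ℝ) (X : Matrix (Fin N) (Fin N) ℝ) :
    Matrix (Fin N × Fin n) (Fin N × Fin n) ℝ :=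
  1 ⊗ₖ A - X ⊗ₖ G

lemma sum_errorMatrix_mul {N n : ℕ} (A G : Matrix (Fin n) (Fin n) ℝ)
    (X : Matrix (Fin N) (Fin N) ℝ) (y : Fin N → Fin n → ℝ) (i : Fin N) (k : Fin n) :
    ∑ q, errorMatrix A G X (i, k) q * y q.1 q.2 =
      (A *ᵥ y i) k - (G *ᵥ ∑ j, X i j • y j) k := by
  have h1 : ∑ q : Fin N × Fin n, (1 : Matrix (Fin N) (Fin N) ℝ) i q.1 * A k q.2 * y q.1 q.2 =
      (A *ᵥ y i) k := by
    simp [Fintype.sum_prod_type, one_apply, mulVec, dotProduct]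
  have h2 : ∑ q : Fin N × Fin n, X i q.1 * G k q.2 * y q.1 q.2 =
      (G *ᵥ ∑ j, X i j • y j) k := by
    simp only [Fintype.sum_prod_type, mulVec, dotProduct, Finset.sum_apply, Pi.smul_apply,
      smul_eq_mul, Finset.mul_sum]
    rw [Finset.sum_comm]
    exact Finset.sum_congr rfl fun _ _ => Finset.sum_congr rfl fun _ _ => by ring
  simp only [errorMatrix, Matrix.sub_apply, kroneckerMap_apply, sub_mul, Finset.sum_sub_distrib,
    h1, h2]

open scoped Kronecker in
/-- `V e = ∑ σᵢ eᵢᵀ P eᵢ` decreases at rate `ξ` along the averaged error system: `-V' - ξ V` is the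
form of `Ξ ⊗ (-ξ P - (P A + Aᵀ P - ξ P B Bᵀ P)) + (Ξ X + Xᵀ Ξ - ξ Ξ) ⊗ P B Bᵀ P`. -/
theorem lyapunov_decrease {n m N : ℕ} {A : Matrix (Fin n) (Fin n) ℝ} {B : Matrix (Fin n) (Fin m) ℝ}
    {X : Matrix (Fin N) (Fin N) ℝ} {σ : Fin N → ℝ} (hσ : ∀ i, 0 < σ i)
    {P : Matrix (Fin n) (Fin n) ℝ} (hP : P.PosDef) {ξ : ℝ}
    (hX : (weightedSym (diagonal σ) X - ξ • diagonal σ).PosDef)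
    (hric : (-(ξ • P) - (P * A + Aᵀ * P - ξ • (P * B * Bᵀ * P))).PosSemidef)
    (v : Fin N × Fin n → ℝ) :
    2 * (v ⬝ᵥ (diagonal σ ⊗ₖ P) *ᵥ (errorMatrix A (B * (Bᵀ * P)) X *ᵥ v)) ≤
      -ξ * (v ⬝ᵥ (diagonal σ ⊗ₖ P) *ᵥ v) := by
  have hPt := posDef_transpose_eq hP
  set Q := diagonal σ ⊗ₖ P with hQ
  set E := errorMatrix A (B * (Bᵀ * P)) X with hE
  have hQt : Qᵀ = Q := by
    rw [hQ, ← kroneckerMap_transpose, hPt, diagonal_transpose]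
  have hG : (P * B * Bᵀ * P).PosSemidef := by
    have h := posSemidef_self_mul_conjTranspose (P * B)
    rwa [conjTranspose_eq_transpose_of_trivial, transpose_mul, hPt, ← Matrix.mul_assoc] at h
  have hGt : (P * B * Bᵀ * P)ᵀ = P * B * Bᵀ * P := by
    simp [transpose_mul, hPt, Matrix.mul_assoc]
  have hQE : Q * E = diagonal σ ⊗ₖ (P * A) - (diagonal σ * X) ⊗ₖ (P * B * Bᵀ * P) := by
    rw [hQ, hE, errorMatrix, Matrix.mul_sub, ← mul_kronecker_mul, ← mul_kronecker_mul,
      Matrix.mul_one]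
    simp only [Matrix.mul_assoc]
  have hEQ : Eᵀ * Q = diagonal σ ⊗ₖ (Aᵀ * P) - (Xᵀ * diagonal σ) ⊗ₖ (P * B * Bᵀ * P) := by
    have h := congrArg transpose hQE
    rwa [transpose_mul, hQt, transpose_sub, ← kroneckerMap_transpose, ← kroneckerMap_transpose,
      diagonal_transpose, transpose_mul, transpose_mul, hPt, diagonal_transpose, hGt] at h
  have hid : -(Q * E + Eᵀ * Q) - ξ • Q =
      diagonal σ ⊗ₖ (-(ξ • P) - (P * A + Aᵀ * P - ξ • (P * B * Bᵀ * P))) +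
        (weightedSym (diagonal σ) X - ξ • diagonal σ) ⊗ₖ (P * B * Bᵀ * P) := by
    rw [hQE, hEQ, weightedSym, hQ]
    ext ⟨i, k⟩ ⟨j, l⟩
    simp only [Matrix.sub_apply, Matrix.add_apply, Matrix.neg_apply, Matrix.smul_apply,
      kroneckerMap_apply, smul_eq_mul]
    ring
  have hpsd : (-(Q * E + Eᵀ * Q) - ξ • Q).PosSemidef := by
    rw [hid]
    exact ((PosSemidef.diagonal fun i => (hσ i).le).kronecker hric).add
      (hX.posSemidef.kronecker hG)
  have h := hpsd.dotProduct_mulVec_nonneg v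
  have hsymm : v ⬝ᵥ (Eᵀ * Q) *ᵥ v = v ⬝ᵥ Q *ᵥ (E *ᵥ v) := by
    rw [← hQt, ← transpose_mul, mulVec_transpose, dotProduct_comm, ← dotProduct_mulVec, hQt,
      mulVec_mulVec]
  rw [star_trivial, sub_mulVec, neg_mulVec, add_mulVec, smul_mulVec, dotProduct_sub,
    dotProduct_neg, dotProduct_add, hsymm, dotProduct_smul, smul_eq_mul, ← mulVec_mulVec] at h
  linarith

/-! ### Consequences of the in-degree balance -/

section Balance

variable {N p : ℕ} {cl : Fin N → Fin p} {a : Matrix (Fin N) (Fin N) ℝ}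

lemma InDegreeBalanced.sum_mul_eq_zero (hbal : InDegreeBalanced cl a) {i : Fin N} {g : Fin p → ℝ}
    (hg : g (cl i) = 0) : ∑ j, g (cl j) * a i j = 0 := by
  rw [← Finset.sum_fiberwise Finset.univ cl]
  refine Finset.sum_eq_zero fun l _ => ?_
  have h1 : ∑ j with cl j = l, g (cl j) * a i j = g l * ∑ j with cl j = l, a i j := by
    rw [Finset.mul_sum]
    exact Finset.sum_congr rfl fun j hj => by rw [(Finset.mem_filter.1 hj).2]
  rw [h1]
  rcases eq_or_ne (cl i) l with rfl | hne
  · rw [hg, zero_mul]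
  · rw [hbal l i hne, mul_zero]

lemma InDegreeBalanced.sum_laplacian_eq_zero (hbal : InDegreeBalanced cl a) (i : Fin N) :
    ∑ j with cl j = cl i, laplacian a i j = 0 := by
  have h1 := hbal.sum_mul_eq_zero (i := i) (g := fun l => if l = cl i then 0 else 1) (by simp)
  have h2 : ∑ j with cl j = cl i, diagonal (fun i => ∑ j, a i j) i j = ∑ j, a i j := by
    rw [Finset.sum_eq_single_of_mem i (by simp) fun j _ hj => diagonal_apply_ne' _ hj,
      diagonal_apply_eq]
  simp only [laplacian, Matrix.sub_apply, Finset.sum_sub_distrib, h2]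
  rw [Finset.sum_filter, ← Finset.sum_sub_distrib]
  exact Eq.trans (Finset.sum_congr rfl fun j _ => by split_ifs <;> ring) h1

/-- The leader states cancel in the coupling terms, which leaves the coupled Laplacian acting on
the errors. -/
lemma InDegreeBalanced.sum_coupling_eq (hbal : InDegreeBalanced cl a) (c : Fin p → ℝ)
    (d x : Fin N → ℝ) (z : Fin p → ℝ) (i : Fin N) :
    ∑ j, coupling cl c i j * a i j * (x j - x i) + c (cl i) * d i * (z (cl i) - x i) =
      -∑ j, coupledLaplacian cl c (laplacian a) (diagonal d) i j * (x j - z (cl j)) := by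
  have h1 := hbal.sum_mul_eq_zero (i := i) (g := fun l => z l - z (cl i)) (by simp)
  have h2 := hbal.sum_mul_eq_zero (i := i) (g := fun l => if cl i = l then 0 else 1 - c (cl i))
    (by simp)
  have hdiag : ∀ r : Fin N → ℝ, ∑ j, diagonal r i j * (x j - z (cl j)) =
      r i * (x i - z (cl i)) := fun r => by
    rw [Finset.sum_eq_single i (fun j _ hj => by rw [diagonal_apply_ne' _ hj, zero_mul])
      (by simp), diagonal_apply_eq]
  have hL : ∑ j, coupledLaplacian cl c (laplacian a) (diagonal d) i j * (x j - z (cl j)) =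
      c (cl i) * ((∑ j, a i j) * (x i - z (cl i))) + c (cl i) * (d i * (x i - z (cl i))) -
        ∑ j, coupling cl c i j * a i j * (x j - z (cl j)) := by
    rw [← hdiag d, ← hdiag fun i => ∑ j, a i j, Finset.mul_sum, Finset.mul_sum,
      ← Finset.sum_add_distrib, ← Finset.sum_sub_distrib]
    refine Finset.sum_congr rfl fun j _ => ?_
    simp only [coupledLaplacian, laplacian, of_apply, Matrix.sub_apply]
    rcases eq_or_ne i j with rfl | hij
    · simp only [coupling, if_true]
      ring
    · simp only [diagonal_apply_ne _ hij]
      ring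
  have h3 : ∑ j, coupling cl c i j * a i j * (x j - x i) =
      ∑ j, coupling cl c i j * a i j * (x j - z (cl j)) +
        ∑ j, (z (cl j) - z (cl i)) * a i j -
        ((∑ j, (if cl i = cl j then 0 else 1 - c (cl i)) * a i j) + c (cl i) * ∑ j, a i j) *
          (x i - z (cl i)) := by
    rw [Finset.mul_sum, ← Finset.sum_add_distrib, ← Finset.sum_add_distrib, Finset.sum_mul,
      ← Finset.sum_sub_distrib]
    refine Finset.sum_congr rfl fun j _ => ?_
    by_cases hij : cl i = cl j
    · simp only [coupling, hij, if_true]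
      ring
    · simp only [coupling, hij, if_false]
      ring
  rw [hL, h3, h1, h2]
  ring

lemma InDegreeBalanced.pinningControl_eq (hbal : InDegreeBalanced cl a) {n m : ℕ} (c : Fin p → ℝ)
    (K : Matrix (Fin m) (Fin n) ℝ) (d : Fin N → ℝ) (x : Fin N → Fin n → ℝ) (z : Fin p → Fin n → ℝ)
    (i : Fin N) :
    pinningControl cl c K a d x z i =
      -(K *ᵥ ∑ j, coupledLaplacian cl c (laplacian a) (diagonal d) i j • (x j - z (cl j))) := by
  rw [pinningControl, ← mulVec_neg]
  congr 1
  ext k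
  simpa using hbal.sum_coupling_eq c d (fun j => x j k) (fun l => z l k) i

end Balance

/-! ### The error system -/

section ErrorSystem

variable {n m N p : ℕ} {A : Matrix (Fin n) (Fin n) ℝ} {B : Matrix (Fin n) (Fin m) ℝ}
  {cl : Fin N → Fin p} {c : Fin p → ℝ} {K : Matrix (Fin m) (Fin n) ℝ}
  {a : ℝ → Matrix (Fin N) (Fin N) ℝ} {d : ℝ → Fin N → ℝ}

lemma hasUniformMean_coupledLaplacian {Linf Dinf : Matrix (Fin N) (Fin N) ℝ}
    (hL : HasAverage (fun t => laplacian (a t)) Linf)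
    (hD : HasAverage (fun t => diagonal (d t)) Dinf) (i j : Fin N) :
    HasUniformMean (fun t => coupledLaplacian cl c (laplacian (a t)) (diagonal (d t)) i j)
      (coupledLaplacian cl c Linf Dinf i j) :=
  ((hL.hasUniformMean i j).const_mul _).add ((hD.hasUniformMean i j).const_mul _)

lemma HasUniformMean.errorMatrix {X : ℝ → Matrix (Fin N) (Fin N) ℝ} {Xinf : Matrix (Fin N) (Fin N) ℝ}
    (hX : ∀ i j, HasUniformMean (fun t => X t i j) (Xinf i j)) (A G : Matrix (Fin n) (Fin n) ℝ)
    (q r : Fin N × Fin n) :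
    HasUniformMean (fun t => errorMatrix A G (X t) q r) (errorMatrix A G Xinf q r) := by
  have h := (HasUniformMean.const ((1 : Matrix (Fin N) (Fin N) ℝ) q.1 r.1 * A q.2 r.2)).add
    ((hX q.1 r.1).const_mul (-G q.2 r.2))
  have hentry : ∀ Y : Matrix (Fin N) (Fin N) ℝ, ClusterSync.errorMatrix A G Y q r =
      (1 : Matrix (Fin N) (Fin N) ℝ) q.1 r.1 * A q.2 r.2 + -G q.2 r.2 * Y q.1 r.1 := fun Y => by
    simp only [ClusterSync.errorMatrix, Matrix.sub_apply, kroneckerMap_apply]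
    ring
  simpa only [hentry] using h

/-- The errors `x i - z (cl i)` of a trajectory, as a vector indexed by agents and coordinates. -/
def stackedError (cl : Fin N → Fin p) (x : ℝ → Fin N → Fin n → ℝ) (z : ℝ → Fin p → Fin n → ℝ)
    (t : ℝ) (q : Fin N × Fin n) : ℝ :=
  x t q.1 q.2 - z t (cl q.1) q.2

theorem IsTrajectory.isLinearSolution {ε t₀ : ℝ} {x : ℝ → Fin N → Fin n → ℝ}
    {z : ℝ → Fin p → Fin n → ℝ} (h : IsTrajectory A B cl c K a d ε t₀ x z) (ht₀ : 0 ≤ t₀)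
    (hε : 0 < ε) (hbal : ∀ t, 0 ≤ t → InDegreeBalanced cl (a t))
    {X : ℝ → Matrix (Fin N) (Fin N) ℝ}
    (hX : ∀ t, X t = coupledLaplacian cl c (laplacian (a t)) (diagonal (d t)))
    {Xinf : Matrix (Fin N) (Fin N) ℝ} (hmean : ∀ i j, HasUniformMean (fun t => X t i j) (Xinf i j)) :
    IsLinearSolution (fun t => errorMatrix A (B * K) (X (t / ε))) t₀ (stackedError cl x z) := by
  have hcont : ContinuousOn (stackedError cl x z) (Ici t₀) :=
    continuousOn_pi.2 fun q =>
      ((continuous_apply q.2).comp_continuousOn (h.agents_continuous q.1)).sub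
        ((continuous_apply q.2).comp_continuousOn (h.leaders_continuous (cl q.1)))
  refine ⟨hcont, ?_⟩
  rintro ⟨i, k⟩ t ht
  have hsub : Icc t₀ t ⊆ Ici t₀ := fun s hs => hs.1
  set u := fun s i => pinningControl cl c K (a (s / ε)) (d (s / ε)) (x s) (z s) i
  have hagent : ∀ k s, t₀ ≤ s → (A *ᵥ x s i + B *ᵥ u s i) k = (A *ᵥ z s (cl i)) k +
      ∑ q, errorMatrix A (B * K) (X (s / ε)) (i, k) q * stackedError cl x z s q := by
    intro k s hs
    have h1 := sum_errorMatrix_mul A (B * K) (X (s / ε)) (fun j => x s j - z s (cl j)) i k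
    simp only [Pi.sub_apply] at h1
    simp only [stackedError, h1]
    simp only [u, (hbal (s / ε) (div_nonneg (ht₀.trans hs) hε.le)).pinningControl_eq, ← hX,
      mulVec_neg, mulVec_mulVec, mulVec_sub, Pi.add_apply, Pi.neg_apply, Pi.sub_apply]
    ring
  have hlead : ∀ k, IntervalIntegrable (fun s => (A *ᵥ z s (cl i)) k) MeasureTheory.volume t₀ t :=
    fun k => ContinuousOn.intervalIntegrable (by
      rw [uIcc_of_le ht]
      exact ((continuous_const.matrix_mulVec continuous_id).comp_continuousOn
        (h.leaders_continuous (cl i)) |> (continuous_apply k).comp_continuousOn).mono hsub)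
  have herr : ∀ k, IntervalIntegrable
      (fun s => ∑ q, errorMatrix A (B * K) (X (s / ε)) (i, k) q * stackedError cl x z s q)
      MeasureTheory.volume t₀ t := fun k => by
    simp only [← Finset.sum_fn]
    refine IntervalIntegrable.sum Finset.univ fun q _ => ?_
    have hq := HasUniformMean.errorMatrix hmean A (B * K) (i, k) q
    obtain ⟨C, hC⟩ := hq.bounded
    exact intervalIntegrable_mul_continuousOn (hq.measurable.comp (measurable_id.div_const ε)) ht
      (fun s hs => hC _ (div_nonneg (ht₀.trans hs) hε.le))
      (((continuous_apply q).comp_continuousOn hcont).mono hsub)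
  have hagent_int : ∀ k, IntervalIntegrable (fun s => (A *ᵥ x s i + B *ᵥ u s i) k)
      MeasureTheory.volume t₀ t := fun k =>
    ((hlead k).add (herr k)).congr fun s hs => by
      rw [uIoc_of_le ht] at hs
      exact (hagent k s hs.1.le).symm
  -- The integral of a vector function has the junk value `0` unless all coordinates are integrable.
  have heval : ∀ f : ℝ → Fin n → ℝ,
      (∀ k, IntervalIntegrable (fun s => f s k) MeasureTheory.volume t₀ t) →
      (∫ s in t₀..t, f s) k = ∫ s in t₀..t, f s k := fun f hf => by
    rw [intervalIntegral.integral_of_le ht, intervalIntegral.integral_of_le ht]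
    exact MeasureTheory.eval_integral
      (fun k => (intervalIntegrable_iff_integrableOn_Ioc_of_le ht).1 (hf k)) k
  have hx := congrFun (h.agents_eq i t ht) k
  have hz := congrFun (h.leaders_eq (cl i) t ht) k
  rw [Pi.add_apply, heval _ hagent_int] at hx
  rw [Pi.add_apply, heval _ hlead] at hz
  have hint : ∫ s in t₀..t, (A *ᵥ x s i + B *ᵥ u s i) k = (∫ s in t₀..t, (A *ᵥ z s (cl i)) k) +
      ∫ s in t₀..t, ∑ q, errorMatrix A (B * K) (X (s / ε)) (i, k) q * stackedError cl x z s q := by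
    rw [← intervalIntegral.integral_add (hlead k) (herr k)]
    refine intervalIntegral.integral_congr fun s hs => ?_
    rw [uIcc_of_le ht] at hs
    exact hagent k s hs.1
  change x t i k - z t (cl i) k = x t₀ i k - z t₀ (cl i) k + _
  rw [hx, hz, hint]
  ring

lemma norm_stackedError_le (x : ℝ → Fin N → Fin n → ℝ) (z : ℝ → Fin p → Fin n → ℝ) (t : ℝ) :
    ‖stackedError cl x z t‖ ≤ errorNorm cl (x t) (z t) := by
  refine (pi_norm_le_iff_of_nonneg (Real.sqrt_nonneg _)).2 fun ⟨i, k⟩ => Real.abs_le_sqrt ?_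
  exact (Finset.single_le_sum (f := fun k => (x t i k - z t (cl i) k) ^ 2)
    (fun _ _ => sq_nonneg _) (Finset.mem_univ k)).trans
    (Finset.single_le_sum (f := fun i => ∑ k, (x t i k - z t (cl i) k) ^ 2)
      (fun _ _ => Finset.sum_nonneg fun _ _ => sq_nonneg _) (Finset.mem_univ i))

lemma errorNorm_le (x : ℝ → Fin N → Fin n → ℝ) (z : ℝ → Fin p → Fin n → ℝ) (t : ℝ) :
    errorNorm cl (x t) (z t) ≤ √(N * n) * ‖stackedError cl x z t‖ := by
  refine Real.sqrt_le_iff.2 ⟨by positivity, ?_⟩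
  rw [mul_pow, Real.sq_sqrt (by positivity)]
  calc _ ≤ ∑ _i : Fin N, ∑ _k : Fin n, ‖stackedError cl x z t‖ ^ 2 := by
        refine Finset.sum_le_sum fun i _ => Finset.sum_le_sum fun k _ => ?_
        rw [← sq_abs]
        exact pow_le_pow_left₀ (abs_nonneg _) (norm_le_pi_norm (stackedError cl x z t) (i, k)) 2
    _ = N * n * ‖stackedError cl x z t‖ ^ 2 := by simp [mul_assoc]

theorem exists_exponentialClusterSync {Linf Dinf : Matrix (Fin N) (Fin N) ℝ}
    (hbal : ∀ t, 0 ≤ t → InDegreeBalanced cl (a t))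
    (hL : HasAverage (fun t => laplacian (a t)) Linf)
    (hD : HasAverage (fun t => diagonal (d t)) Dinf) {σ : Fin N → ℝ} (hσ : ∀ i, 0 < σ i)
    {P : Matrix (Fin n) (Fin n) ℝ}
    (hP : IsGainDesign A B (coupledLaplacian cl c Linf Dinf) σ P) :
    ∃ ε₀ : ℝ, 0 < ε₀ ∧ ∀ ε : ℝ, 0 < ε → ε < ε₀ →
      ExponentialClusterSync A B cl c (Bᵀ * P) a d ε := by
  obtain ⟨hPpd, ξ, hξ, hX, hric⟩ := hP
  have hmean := fun i j => hasUniformMean_coupledLaplacian (cl := cl) (c := c) hL hD i j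
  obtain ⟨ε₀, hε₀, hdecay⟩ := exists_exponential_decay_of_average
    (HasUniformMean.errorMatrix hmean A (B * (Bᵀ * P)))
    ((PosDef.diagonal hσ).kronecker hPpd) hξ (lyapunov_decrease hσ hPpd hX hric)
  refine ⟨ε₀, hε₀, fun ε hε hlt => ?_⟩
  obtain ⟨C, rate, hC, hrate, hdec⟩ := hdecay ε hε hlt
  refine ⟨√(N * n) * C + 1, rate, by positivity, hrate, fun t₀ x z ht₀ htraj t ht => ?_⟩
  have hsol := htraj.isLinearSolution ht₀ hε hbal (fun _ => rfl) hmean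
  have hE0 : 0 ≤ errorNorm cl (x t₀) (z t₀) := Real.sqrt_nonneg _
  calc errorNorm cl (x t) (z t) ≤ √(N * n) * ‖stackedError cl x z t‖ := errorNorm_le x z t
    _ ≤ √(N * n) * (C * Real.exp (-rate * (t - t₀)) * errorNorm cl (x t₀) (z t₀)) := by
        gcongr
        refine (hdec t₀ _ ht₀ hsol t ht).trans ?_
        gcongr
        exact norm_stackedError_le x z t₀
    _ = √(N * n) * C * Real.exp (-rate * (t - t₀)) * errorNorm cl (x t₀) (z t₀) := by ring
    _ ≤ (√(N * n) * C + 1) * Real.exp (-rate * (t - t₀)) * errorNorm cl (x t₀) (z t₀) := by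
        gcongr
        linarith

end ErrorSystem

/-! ### Structure of the averages -/

lemma HasAverage.apply_eq_zero_of_diagonal {N : ℕ} {d : ℝ → Fin N → ℝ}
    {Dinf : Matrix (Fin N) (Fin N) ℝ} (hD : HasAverage (fun t => diagonal (d t)) Dinf)
    {i j : Fin N} (hij : i ≠ j) : Dinf i j = 0 :=
  (hD.hasUniformMean i j).unique <|
    (HasUniformMean.const 0).congr_nonneg (hD.hasUniformMean i j).measurable
      fun t _ => diagonal_apply_ne (d t) hij

lemma HasAverage.sum_laplacian_eq_zero {N p : ℕ} {cl : Fin N → Fin p}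
    {a : ℝ → Matrix (Fin N) (Fin N) ℝ} (hbal : ∀ t, 0 ≤ t → InDegreeBalanced cl (a t))
    {Linf : Matrix (Fin N) (Fin N) ℝ} (hL : HasAverage (fun t => laplacian (a t)) Linf)
    (i : Fin N) : ∑ j with cl j = cl i, Linf i j = 0 := by
  have h := HasUniformMean.sum (Finset.univ.filter fun j => cl j = cl i)
    fun j _ => hL.hasUniformMean i j
  exact h.unique <| (HasUniformMean.const 0).congr_nonneg h.measurable
    fun t ht => (hbal t ht).sum_laplacian_eq_zero i

end ClusterSync

end

theorem theorem1 {n m N p : ℕ}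
    (A : Matrix (Fin n) (Fin n) ℝ) (B : Matrix (Fin n) (Fin m) ℝ)
    (cl : Fin N → Fin p) (hcl : Function.Surjective cl)
    (γ : ℝ → Matrix (Fin N) (Fin N) ℝ) (α : Matrix (Fin N) (Fin N) ℝ) (d : ℝ → Fin N → ℝ)
    (Linf Dinf : Matrix (Fin N) (Fin N) ℝ)
    (hAB : ClusterSync.Stabilizable A B)
    (hbal : ∀ t, 0 ≤ t → ClusterSync.InDegreeBalanced cl (ClusterSync.trustAdjacency γ α t))
    (hL : ClusterSync.HasAverage
      (fun t => ClusterSync.laplacian (ClusterSync.trustAdjacency γ α t)) Linf)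
    (hD : ClusterSync.HasAverage (fun t => Matrix.diagonal (d t)) Dinf)
    (hLnonneg : ∀ i j, i ≠ j → cl i = cl j → Linf i j ≤ 0)
    (hDnonneg : ∀ i, 0 ≤ Dinf i i)
    (htree : ∀ l, ClusterSync.HasSpanningTree (ClusterSync.leaderGraph cl Linf Dinf l)) :
    (∃ σ : Fin N → ℝ, ClusterSync.IsWeighting cl (Linf + Dinf) σ) ∧
    ∀ σ : Fin N → ℝ, ClusterSync.IsWeighting cl (Linf + Dinf) σ →
      ∀ c : Fin p → ℝ, (∀ l, ClusterSync.couplingThreshold cl Linf Dinf σ l < c l) →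
        (∃ P, ClusterSync.IsGainDesign A B
          (ClusterSync.coupledLaplacian cl c Linf Dinf) σ P) ∧
        ∀ P, ClusterSync.IsGainDesign A B
            (ClusterSync.coupledLaplacian cl c Linf Dinf) σ P →
          ∃ ε₀ : ℝ, 0 < ε₀ ∧ ∀ ε : ℝ, 0 < ε → ε < ε₀ →
            ClusterSync.ExponentialClusterSync A B cl c (Bᵀ * P)
              (ClusterSync.trustAdjacency γ α) d ε := by
  have hDdiag : ∀ i j, i ≠ j → Dinf i j = 0 := fun _ _ hij => hD.apply_eq_zero_of_diagonal hij
  refine ⟨ClusterSync.exists_isWeighting (hL.sum_laplacian_eq_zero hbal) hLnonneg hDnonneg hDdiag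
    htree, fun σ hσ c hc => ⟨ClusterSync.exists_isGainDesign hAB
      (ClusterSync.posDef_weightedSym_coupledLaplacian hcl hDdiag hσ hc), fun P hP =>
        ClusterSync.exists_exponentialClusterSync hbal hL hD hσ.1 hP⟩⟩
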